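/- Let $G$ be a finite simple graph with vertex set $V$ and, for a field $K$, let $K(G)=K[x_v : v\in V]$ be the polynomial ring on the vertices of $G$, with the standard grading. Let $\Delta(G)$ be the simplicial complex on $V$ whose faces are the sets of vertices no two of which are joined by an edge of $G$, and let $K[\Delta(G)]$ be its Stanley--Reisner ring, i.e. $K[\Delta(G)]=K(G)/I(G)$, where $I(G)$ is the ideal generated by the monomials $x_ux_v$ for the edges $\{u,v\}$ of $G$. For every field $K$ there is a graded minimal finite free resolution $$0\to\bigoplus_j R(-j)^{\beta_{pj}}\to\cdots\to\bigoplus_j R(-j)^{\beta_{1j}}\to R\to K[\Delta(G)]\to 0,\qquad R=K(G),$$ and the $i$th (total) Betti number of $K[\Delta(G)]$ is $\beta_i^K(G)=\sum_j\beta_{ij}$, read off from any such resolution. (Here $\beta_{00}=1$ and $\beta_{0j}=0$ for $j\ne0$.) For every $0\le i\le 5$ the number $\beta_i^K(G)$ does not depend on the characteristic of $K$, nor otherwise on the field or on the resolution: $\beta_i^K(G)=\beta_i^L(G)$ for any two fields $K$ and $L$ and any choice of such resolutions over them. -/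

import Mathlib

open MvPolynomial

/-- The independence complex `Δ(G)` of a simple graph `G`: its vertices are the vertices of `G`, and
its faces are the sets of vertices no two of which are joined by an edge. (Mathlib's convention
leaves the empty face implicit.) -/
def independenceComplex {V : Type*} (G : SimpleGraph V) : AbstractSimplicialComplex V where
  faces := {s : Finset V | s.Nonempty ∧ G.IsIndepSet (s : Set V)}
  isRelLowerSet_faces := fun _ hs =>
    ⟨hs.1, fun _ hts ht => ⟨ht, Set.Pairwise.mono (Finset.coe_subset.mpr hts) hs.2⟩⟩
  singleton_mem := fun v => ⟨Finset.singleton_nonempty v, by simp [SimpleGraph.IsIndepSet]⟩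

/-- The Stanley–Reisner ideal of a simplicial complex `Δ` with vertex set `V`, over `K`: the ideal
of the polynomial ring in the vertices generated by the square-free monomials `∏_{v ∈ s} x_v`, for
the (nonempty) sets `s` of vertices that are not faces of `Δ`. The quotient by this ideal is the
Stanley–Reisner ring `K[Δ]`. -/
noncomputable def stanleyReisnerIdeal (K : Type*) [Field K] {V : Type*} (Δ : AbstractSimplicialComplex V) :
    Ideal (MvPolynomial V K) :=
  Ideal.span {f | ∃ s : Finset V, s.Nonempty ∧ s ∉ Δ.faces ∧ f = ∏ v ∈ s, X v}

/-- The edge ideal `I(G)` in the polynomial ring `K(G)` on the vertices of `G`, generated by the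
monomials `x_u x_v` for the edges `{u, v}` of `G`. -/
noncomputable def edgeIdeal (K : Type*) [Field K] {V : Type*} (G : SimpleGraph V) : Ideal (MvPolynomial V K) :=
  Ideal.span {f | ∃ u v : V, G.Adj u v ∧ f = X u * X v}

/-- `K[Δ(G)] = K(G) / I(G)`. -/
theorem stanleyReisnerIdeal_independenceComplex (K : Type*) [Field K] {V : Type*}
    (G : SimpleGraph V) :
    stanleyReisnerIdeal K (independenceComplex G) = edgeIdeal K G := by
  classical
  apply le_antisymm
  · refine Ideal.span_le.mpr ?_
    rintro f ⟨s, hs, hns, rfl⟩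
    have hns' : ¬ G.IsIndepSet (s : Set V) := fun h => hns ⟨hs, h⟩
    rw [SimpleGraph.isIndepSet_iff, Set.Pairwise] at hns'
    push Not at hns'
    obtain ⟨u, hu, v, hv, huv, hadj⟩ := hns'
    have h : (∏ w ∈ ({u, v} : Finset V), (X w : MvPolynomial V K)) ∣ ∏ w ∈ s, X w := by
      apply Finset.prod_dvd_prod_of_subset
      intro w hw
      rcases Finset.mem_insert.mp hw with rfl | hw
      · exact hu
      · rw [Finset.mem_singleton.mp hw]
        exact hv
    rw [Finset.prod_pair huv] at h
    exact Ideal.mem_of_dvd _ h (Ideal.subset_span ⟨u, v, hadj, rfl⟩)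
  · refine Ideal.span_le.mpr ?_
    rintro f ⟨u, v, hadj, rfl⟩
    refine Ideal.subset_span ⟨{u, v}, Finset.insert_nonempty _ _, fun h => ?_, ?_⟩
    · exact h.2 (by simp) (by simp) hadj.ne hadj
    · rw [Finset.prod_pair hadj.ne]

/-- The free module `⨁_j R(-j)^{b j}` over the polynomial ring `R = K[x_v : v ∈ V]`, with its basis
indexed by the pairs `⟨j, k⟩`, `k < b j`; the basis element `⟨j, k⟩` has degree `j`. -/
abbrev GradedFree (K : Type*) [Field K] (V : Type*) (b : ℕ →₀ ℕ) :=
  (Σ j : ℕ, Fin (b j)) →₀ MvPolynomial V K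

/-- A graded minimal finite free resolution
`0 → ⨁_j R(-j)^{β p j} → ⋯ → ⨁_j R(-j)^{β 1 j} → R → R/I → 0`
of `R/I`, for an ideal `I` of the polynomial ring `R = K[x_v : v ∈ V]`. -/
structure MinimalGradedFreeResolution {K : Type*} [Field K] {V : Type*}
    (I : Ideal (MvPolynomial V K)) where
  /-- `β i j` is the number of basis elements of degree `j` of the `i`th free module. -/
  β : ℕ → ℕ →₀ ℕ
  /-- the differentials -/
  d : ∀ i : ℕ, GradedFree K V (β (i + 1)) →ₗ[MvPolynomial V K] GradedFree K V (β i)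
  /-- The free module in homological degree `0` is `R` itself. -/
  β_zero : β 0 = Finsupp.single 0 1
  /-- The resolution has finite length. -/
  finite_length : ∃ p : ℕ, ∀ i, p < i → β i = 0
  /-- The differentials preserve degrees: all monomials of the matrix entry at a basis element `b`
  of the source and a basis element `a` of the target have degree `deg b - deg a`. -/
  graded : ∀ (i : ℕ) (b : Σ j : ℕ, Fin (β (i + 1) j)) (a : Σ j : ℕ, Fin (β i j)),
    ∀ m ∈ (d i (Finsupp.single b 1) a).support, a.1 + m.degree = b.1
  /-- Minimality: all entries of the matrices of the differentials are in the ideal generated by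
  the variables. -/
  minimal : ∀ (i : ℕ) (b : Σ j : ℕ, Fin (β (i + 1) j)) (a : Σ j : ℕ, Fin (β i j)),
    constantCoeff (d i (Finsupp.single b 1) a) = 0
  /-- Exactness at `R`; the map `R → R/I` is the canonical surjection, which sends the single basis
  element of `R` to `1`. -/
  exact_zero : Function.Exact (d 0) (Finsupp.linearCombination (MvPolynomial V K)
    fun _ : Σ j : ℕ, Fin (β 0 j) => (1 : MvPolynomial V K ⧸ I))
  /-- Exactness in positive homological degrees. -/
  exact_succ : ∀ i : ℕ, Function.Exact (d (i + 1)) (d i)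

/-- The `i`th Betti number `β_i = ∑_j β_{i,j}` read off from a minimal resolution. -/
def MinimalGradedFreeResolution.betti {K : Type*} [Field K] {V : Type*}
    {I : Ideal (MvPolynomial V K)} (F : MinimalGradedFreeResolution I) (i : ℕ) : ℕ :=
  (F.β i).sum fun _ n => n

/-!
The Betti numbers of `K[Δ(G)]` are the dimensions of the Koszul homology of `K[Δ(G)]`: the Koszul
complex of the variables with free coefficients is exact in positive degrees, so dimension
shifting along a minimal resolution identifies the rank of its `i`th term
with the dimension of the `i`th Koszul homology
(`koszulDim_eq_card_of_resolution`). The Koszul complex splits by multidegrees. Multidegrees that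
are not square-free contribute nothing, because division by a repeated variable gives a homotopy;
and the part in the square-free multidegree with support `W` is the augmented cochain complex of
the independence complex of the subgraph induced on `W`. This is Hochster's formula
(`koszulDim_quotient`) `β_i = ∑_W dim H̃^{|W| - i - 1}(Δ(G[W]); K)`.

It remains to see that for `|W| - k ≤ 5` the dimension of `H̃^{k - 1}(Δ(G[W]); K)` does not depend
on `K` (`fieldIndep_of_card_sub_le_five`). The tool is the long exact sequence of a vertex `v`,
which relates `W`, the complement `W \ v` and the link of `v`, that is, the independence complex
on the vertices outside the closed neighbourhood of `v`. It shows that `H̃^{k - 1}` vanishes for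
`|W| < 2k` (`acyclic_of_card_lt`), that for `|W| = 2k` it is nonzero only for perfect matchings
(`acyclic_of_card_eq`), and how to remove vertices whose neighbourhood is special
(`cohDim_of_leaf`, `cohDim_erase_of_nbrs_subset`, `cohDim_of_closed_nbrs_subset`). These rules and
the invariance of the Euler characteristic settle `|W| ≤ 2k + 1`
(`fieldIndep_of_card_le_two_mul_add_one`). The cohomology in dimension zero counts components, so
`k ≤ 1` is clear. For `k ≥ 2`, the remaining cases are `k = 2`, `|W| ≤ 7`, where the cohomology in
all other dimensions is already known to be independent of `K` and the Euler characteristic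
applies (`fieldIndep_two`), and `k = 3`, `|W| = 8`. In the last case (`fieldIndep_three`) the
rules reduce to graphs with degrees two and three in which the vertices outside the closed
neighbourhood of a vertex of degree three form a perfect matching. Such a graph has a vertex of
degree two, and removing one of its neighbours leaves a complex without first cohomology, which
splits the long exact sequence.

Minimal resolutions exist because a graded submodule of a graded free module has a homogeneous
generating family of least size, whose relations have no constant terms (`exists_minimal_cover`).
Iterating gives an exact minimal complex, and it is finite because its ranks are given by
Hochster's formula, in which no `W` contributes for `i > |V|`
(`nonempty_minimalGradedFreeResolution`).
-/

/-! ### Dimensions of subquotients -/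

/-- The dimension of the subquotient `P / (P ∩ Q)` of a vector space. -/
noncomputable def quotDim {K E : Type*} [Field K] [AddCommGroup E] [Module K E]
    (P Q : Submodule K E) : ℕ :=
  Module.finrank K (P ⧸ Q.submoduleOf P)

theorem quotDim_add_finrank {K E : Type*} [Field K] [AddCommGroup E] [Module K E]
    [FiniteDimensional K E] {P Q : Submodule K E} (h : Q ≤ P) :
    quotDim P Q + Module.finrank K Q = Module.finrank K P := by
  rw [quotDim, ← (Submodule.submoduleOfEquivOfLe h).finrank_eq]
  exact Submodule.finrank_quotient_add_finrank _

/-- Two subquotients have the same dimension if they are related by a correspondence `R`, with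
projections `a` and `b`, that is onto both of them and matches the two null spaces. -/
theorem quotDim_eq_of_correspondence {K Y E E' : Type*} [Field K] [AddCommGroup Y] [Module K Y]
    [AddCommGroup E] [Module K E] [AddCommGroup E'] [Module K E'] (R : Submodule K Y)
    (a : Y →ₗ[K] E) (b : Y →ₗ[K] E') {P Q : Submodule K E} {P' Q' : Submodule K E'}
    (ha : ∀ y ∈ R, a y ∈ P) (hb : ∀ y ∈ R, b y ∈ P')
    (sa : ∀ p ∈ P, ∃ y ∈ R, p - a y ∈ Q) (sb : ∀ p ∈ P', ∃ y ∈ R, p - b y ∈ Q')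
    (hab : ∀ y ∈ R, a y ∈ Q ↔ b y ∈ Q') : quotDim P Q = quotDim P' Q' := by
  let α : R →ₗ[K] P ⧸ Q.submoduleOf P := (Q.submoduleOf P).mkQ ∘ₗ a.restrict ha
  let β : R →ₗ[K] P' ⧸ Q'.submoduleOf P' := (Q'.submoduleOf P').mkQ ∘ₗ b.restrict hb
  have hα : Function.Surjective α := by
    intro q
    obtain ⟨p, rfl⟩ := Submodule.mkQ_surjective _ q
    obtain ⟨y, hy, h⟩ := sa p p.2
    refine ⟨⟨y, hy⟩, ((Submodule.Quotient.eq _).mpr ?_).symm⟩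
    simpa [Submodule.submoduleOf, Submodule.mem_comap] using h
  have hβ : Function.Surjective β := by
    intro q
    obtain ⟨p, rfl⟩ := Submodule.mkQ_surjective _ q
    obtain ⟨y, hy, h⟩ := sb p p.2
    refine ⟨⟨y, hy⟩, ((Submodule.Quotient.eq _).mpr ?_).symm⟩
    simpa [Submodule.submoduleOf, Submodule.mem_comap] using h
  have hker : LinearMap.ker α = LinearMap.ker β := by
    ext y
    have h1 : α y = 0 ↔ a y ∈ Q := Submodule.Quotient.mk_eq_zero _
    have h2 : β y = 0 ↔ b y ∈ Q' := Submodule.Quotient.mk_eq_zero _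
    rw [LinearMap.mem_ker, LinearMap.mem_ker, h1, h2, hab y y.2]
  exact ((α.quotKerEquivOfSurjective hα).symm.trans
    ((Submodule.quotEquivOfEq _ _ hker).trans (β.quotKerEquivOfSurjective hβ))).finrank_eq

/-- Dimensions of subquotients of a finite product add up. -/
theorem quotDim_pi {K ι : Type*} [Field K] [Fintype ι] {E : ι → Type*}
    [∀ i, AddCommGroup (E i)] [∀ i, Module K (E i)] [∀ i, FiniteDimensional K (E i)]
    {P Q : ∀ i, Submodule K (E i)} (h : ∀ i, Q i ≤ P i) :
    quotDim (Submodule.pi Set.univ P) (Submodule.pi Set.univ Q) = ∑ i, quotDim (P i) (Q i) := by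
  have key : ∀ p : ∀ i, Submodule K (E i),
      Module.finrank K (Submodule.pi Set.univ p) = ∑ i, Module.finrank K (p i) := by
    intro p
    rw [← Module.finrank_pi_fintype K]
    exact LinearEquiv.finrank_eq
      { toFun := fun x i => ⟨x.1 i, x.2 i trivial⟩
        invFun := fun x => ⟨fun i => (x i).1, fun i _ => (x i).2⟩
        map_add' := fun _ _ => rfl
        map_smul' := fun _ _ => rfl }
  have h1 := quotDim_add_finrank (Submodule.pi_mono (s := Set.univ) (fun i _ => h i))
  rw [key, key, ← Finset.sum_congr rfl (fun i _ => quotDim_add_finrank (h i)),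
    Finset.sum_add_distrib] at h1
  exact Nat.add_right_cancel h1

/-! ### Signed differentials on functions of finite sets -/

section Differential

variable {V : Type*} [LinearOrder V]

/-- The sign `(-1)^m`, where `m` is the number of elements of `A` below `v`: the sign with which
`v` enters `A` in an exterior product. -/
def insertSign (v : V) (A : Finset V) : ℤˣ := (-1) ^ (A.filter (· < v)).card

theorem insertSign_insert {u v : V} {A : Finset V} (hu : u ∉ A) :
    insertSign v (insert u A) = if u < v then -insertSign v A else insertSign v A := by
  unfold insertSign
  rw [Finset.filter_insert]
  split_ifs with h
  · rw [Finset.card_insert_of_notMem (by simp [hu]), pow_succ, mul_neg_one]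
  · rfl

theorem insertSign_mul_insertSign {u v : V} {A : Finset V} (huv : u ≠ v) (hu : u ∉ A)
    (hv : v ∉ A) :
    insertSign u A * insertSign v (insert u A) = -(insertSign v A * insertSign u (insert v A)) := by
  rw [insertSign_insert hu, insertSign_insert hv]
  rcases lt_or_gt_of_ne huv with h | h
  · simp [h, h.not_gt, mul_comm]
  · simp [h, h.not_gt, mul_comm]

theorem insertSign_union {v : V} {A B : Finset V} (h : Disjoint A B) :
    insertSign v (A ∪ B) = insertSign v A * insertSign v B := by
  unfold insertSign
  rw [Finset.filter_union, Finset.card_union_of_disjoint (Finset.disjoint_filter_filter h), pow_add]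

variable {K M N : Type*} [Field K] [AddCommGroup M] [Module K M] [AddCommGroup N] [Module K N]

/-- For endomorphisms `φ v` of `M`, the operator on functions from finite sets to `M` with
`(dif φ f) A = ∑ u ∈ A, ± φ u (f (A \ {u}))`. For `φ = 1` it is the coboundary of a simplex; for
the multiplications by commuting elements it is the differential of the Koszul complex, the set
`A` standing for the exterior product over the complement of `A`. -/
def dif (φ : V → M →ₗ[K] M) : (Finset V → M) →ₗ[K] (Finset V → M) where
  toFun f A := ∑ u ∈ A, insertSign u (A.erase u) • φ u (f (A.erase u))
  map_add' f g := by
    funext A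
    simp [Finset.sum_add_distrib]
  map_smul' c f := by
    funext A
    simp only [Pi.smul_apply, map_smul, RingHom.id_apply, Finset.smul_sum]
    exact Finset.sum_congr rfl fun u _ => smul_comm _ _ _

theorem dif_apply (φ : V → M →ₗ[K] M) (f : Finset V → M) (A : Finset V) :
    dif φ f A = ∑ u ∈ A, insertSign u (A.erase u) • φ u (f (A.erase u)) := rfl

theorem dif_dif {φ : V → M →ₗ[K] M} (hφ : ∀ u v x, φ u (φ v x) = φ v (φ u x))
    (f : Finset V → M) : dif φ (dif φ f) = 0 := by
  funext A
  simp only [dif_apply, Pi.zero_apply, map_sum, Finset.smul_sum, Finset.sum_sigma']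
  refine Finset.sum_involution (fun p _ => ⟨p.2, p.1⟩) ?_ ?_ ?_ ?_
  · rintro ⟨u, w⟩ h
    simp only [Finset.mem_sigma, Finset.mem_erase] at h
    obtain ⟨hu, hwu, hw⟩ := h
    have h1 : insert w ((A.erase u).erase w) = A.erase u :=
      Finset.insert_erase (Finset.mem_erase.mpr ⟨hwu, hw⟩)
    have h2 : insert u ((A.erase u).erase w) = A.erase w := by
      rw [Finset.erase_right_comm]
      exact Finset.insert_erase (Finset.mem_erase.mpr ⟨hwu.symm, hu⟩)
    have key := insertSign_mul_insertSign (A := (A.erase u).erase w) hwu (by simp) (by simp)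
    rw [h1, h2] at key
    have h3 : (A.erase w).erase u = (A.erase u).erase w := Finset.erase_right_comm
    have hs : ∀ (s : ℤˣ) (x : M) (v : V), φ v (s • x) = s • φ v x := fun s x v =>
      LinearMap.map_smul_of_tower (φ v) (s : ℤ) x
    simp only [h3, hs, smul_smul, hφ u w]
    rw [mul_comm, key, mul_comm, Units.neg_smul, neg_add_cancel]
  · rintro ⟨u, w⟩ h _ heq
    simp only [Finset.mem_sigma, Finset.mem_erase] at h
    exact h.2.1 (congrArg Sigma.fst heq)
  · rintro ⟨u, w⟩ h
    simp only [Finset.mem_sigma, Finset.mem_erase] at h ⊢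
    exact ⟨h.2.2, h.2.1.symm, h.1⟩
  · rintro ⟨u, w⟩ _
    rfl

theorem dif_naturality {φ : V → M →ₗ[K] M} {ψ : V → N →ₗ[K] N} (π : M →ₗ[K] N)
    (h : ∀ v x, π (φ v x) = ψ v (π x)) (f : Finset V → M) (A : Finset V) :
    dif ψ (fun T => π (f T)) A = π (dif φ f A) := by
  simp only [dif_apply, map_sum]
  refine Finset.sum_congr rfl fun u _ => ?_
  rw [← h]
  exact (LinearMap.map_smul_of_tower π (_ : ℤ) _).symm

end Differential

/-! ### Cochains of independence complexes -/

section Cochains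

variable {V : Type*} (K : Type*) [Field K] (G : SimpleGraph V)

/-- `A` is a face (possibly empty) of the independence complex of the subgraph induced on `W`. -/
def IsFace (W A : Finset V) : Prop := A ⊆ W ∧ G.IsIndepSet (A : Set V)

variable {G} in
theorem IsFace.mono {W A B : Finset V} (h : IsFace G W A) (hB : B ⊆ A) : IsFace G W B :=
  ⟨hB.trans h.1, Set.Pairwise.mono (Finset.coe_subset.mpr hB) h.2⟩

variable {G} in
theorem IsFace.mono_left {W W' A : Finset V} (h : IsFace G W A) (hW : W ⊆ W') : IsFace G W' A :=
  ⟨h.1.trans hW, h.2⟩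

open Classical in
/-- Restriction of a function of finite sets to the faces on `W`. -/
noncomputable def faceRestrict (W : Finset V) : (Finset V → K) →ₗ[K] (Finset V → K) where
  toFun f A := if IsFace G W A then f A else 0
  map_add' f g := by
    funext A
    by_cases h : IsFace G W A <;> simp [h]
  map_smul' c f := by
    funext A
    by_cases h : IsFace G W A <;> simp [h]

variable {K G} in
theorem faceRestrict_of_isFace {W A : Finset V} (h : IsFace G W A) (f : Finset V → K) :
    faceRestrict K G W f A = f A := if_pos h

variable {K G} in
theorem faceRestrict_of_not_isFace {W A : Finset V} (h : ¬IsFace G W A) (f : Finset V → K) :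
    faceRestrict K G W f A = 0 := if_neg h

/-- The functions supported on the faces on `W` with `k` elements, that is, the cochains of
dimension `k - 1`. -/
def cochains (W : Finset V) (k : ℤ) : Submodule K (Finset V → K) where
  carrier := {f | ∀ A, f A ≠ 0 → IsFace G W A ∧ (A.card : ℤ) = k}
  add_mem' {f g} hf hg A h := by
    by_cases h1 : f A = 0
    · exact hg A fun h2 => h (by simp [h1, h2])
    · exact hf A h1
  zero_mem' A h := absurd rfl h
  smul_mem' c f hf A h := hf A fun h2 => h (by simp [h2])

variable {K G}

theorem cochains_eq_zero_of_not_isFace {W A : Finset V} {k : ℤ} {f : Finset V → K}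
    (hf : f ∈ cochains K G W k) (h : ¬IsFace G W A) : f A = 0 := by
  by_contra h1
  exact h (hf A h1).1

theorem cochains_eq_zero_of_card {W A : Finset V} {k : ℤ} {f : Finset V → K}
    (hf : f ∈ cochains K G W k) (h : (A.card : ℤ) ≠ k) : f A = 0 := by
  by_contra h1
  exact h (hf A h1).2

theorem cochains_mono {W W' : Finset V} (h : W ⊆ W') (k : ℤ) :
    cochains K G W k ≤ cochains K G W' k :=
  fun _ hf A hA => ⟨(hf A hA).1.mono_left h, (hf A hA).2⟩

theorem faceRestrict_mem_cochains {W W' : Finset V} {k : ℤ} {f : Finset V → K}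
    (hf : f ∈ cochains K G W k) : faceRestrict K G W' f ∈ cochains K G W' k := by
  intro A hA
  by_cases h : IsFace G W' A
  · rw [faceRestrict_of_isFace h] at hA
    exact ⟨h, (hf A hA).2⟩
  · exact absurd (faceRestrict_of_not_isFace h f) hA

theorem faceRestrict_eq_self {W : Finset V} {k : ℤ} {f : Finset V → K}
    (hf : f ∈ cochains K G W k) : faceRestrict K G W f = f := by
  funext A
  by_cases h : IsFace G W A
  · exact faceRestrict_of_isFace h f
  · rw [faceRestrict_of_not_isFace h, cochains_eq_zero_of_not_isFace hf h]

theorem faceRestrict_faceRestrict {W W' : Finset V} (h : W' ⊆ W) (f : Finset V → K) :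
    faceRestrict K G W' (faceRestrict K G W f) = faceRestrict K G W' f := by
  funext A
  by_cases hA : IsFace G W' A
  · rw [faceRestrict_of_isFace hA, faceRestrict_of_isFace hA,
      faceRestrict_of_isFace (hA.mono_left h)]
  · rw [faceRestrict_of_not_isFace hA, faceRestrict_of_not_isFace hA]

variable [LinearOrder V]

variable (K G) in
/-- The coboundary of the augmented cochain complex of the independence complex of the subgraph
induced on `W`. -/
noncomputable def cobd (W : Finset V) : (Finset V → K) →ₗ[K] (Finset V → K) :=
  faceRestrict K G W ∘ₗ dif fun _ => LinearMap.id

theorem cobd_of_isFace {W A : Finset V} (h : IsFace G W A) (f : Finset V → K) :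
    cobd K G W f A = ∑ u ∈ A, insertSign u (A.erase u) • f (A.erase u) :=
  faceRestrict_of_isFace h _

theorem cobd_of_not_isFace {W A : Finset V} (h : ¬IsFace G W A) (f : Finset V → K) :
    cobd K G W f A = 0 := faceRestrict_of_not_isFace h _

theorem cobd_faceRestrict {W W' : Finset V} (h : W' ⊆ W) (f : Finset V → K) :
    cobd K G W' (faceRestrict K G W' f) = faceRestrict K G W' (cobd K G W f) := by
  funext A
  by_cases hA : IsFace G W' A
  · rw [cobd_of_isFace hA, faceRestrict_of_isFace hA, cobd_of_isFace (hA.mono_left h)]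
    exact Finset.sum_congr rfl fun u _ => by
      rw [faceRestrict_of_isFace (hA.mono (Finset.erase_subset _ _))]
  · rw [cobd_of_not_isFace hA, faceRestrict_of_not_isFace hA]

theorem cobd_mem_cochains {W : Finset V} {k : ℤ} {f : Finset V → K}
    (hf : f ∈ cochains K G W k) : cobd K G W f ∈ cochains K G W (k + 1) := by
  intro A hA
  by_cases h : IsFace G W A
  · refine ⟨h, ?_⟩
    rw [cobd_of_isFace h] at hA
    obtain ⟨u, hu, hne⟩ := Finset.exists_ne_zero_of_sum_ne_zero hA
    have h1 : f (A.erase u) ≠ 0 := fun h0 => hne (by rw [h0, smul_zero])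
    have := (hf _ h1).2
    rw [Finset.card_erase_of_mem hu] at this
    have := Finset.card_pos.mpr ⟨u, hu⟩
    omega
  · exact absurd (cobd_of_not_isFace h f) hA

theorem cobd_cobd (W : Finset V) (f : Finset V → K) : cobd K G W (cobd K G W f) = 0 := by
  funext A
  by_cases h : IsFace G W A
  · have h0 := congrFun (dif_dif (K := K) (φ := fun _ : V => (LinearMap.id : K →ₗ[K] K))
      (fun _ _ _ => rfl) f) A
    rw [cobd_of_isFace h]
    rw [dif_apply] at h0
    refine Eq.trans (Finset.sum_congr rfl fun u _ => ?_) h0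
    rw [cobd_of_isFace (h.mono (Finset.erase_subset _ _))]
    rfl
  · exact cobd_of_not_isFace h _

variable (K G) in
/-- The cocycles of dimension `k - 1` on `W`. -/
noncomputable def cocycles (W : Finset V) (k : ℤ) : Submodule K (Finset V → K) :=
  cochains K G W k ⊓ LinearMap.ker (cobd K G W)

variable (K G) in
/-- The coboundaries of dimension `k - 1` on `W`. -/
noncomputable def coboundaries (W : Finset V) (k : ℤ) : Submodule K (Finset V → K) :=
  (cochains K G W (k - 1)).map (cobd K G W)

theorem mem_cocycles {W : Finset V} {k : ℤ} {f : Finset V → K} :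
    f ∈ cocycles K G W k ↔ f ∈ cochains K G W k ∧ cobd K G W f = 0 := Iff.rfl

theorem coboundaries_le_cocycles (W : Finset V) (k : ℤ) :
    coboundaries K G W k ≤ cocycles K G W k := by
  rintro _ ⟨f, hf, rfl⟩
  have := cobd_mem_cochains hf
  rw [sub_add_cancel] at this
  exact ⟨this, cobd_cobd W f⟩

variable (K G) in
/-- The dimension of the reduced cohomology in dimension `k - 1` of the independence complex of
the subgraph induced on `W`. -/
noncomputable def cohDim (W : Finset V) (k : ℤ) : ℕ :=
  quotDim (cocycles K G W k) (coboundaries K G W k)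

variable (K G) in
/-- The reduced cohomology on `W` vanishes in dimension `k - 1`. -/
def Acyclic (W : Finset V) (k : ℤ) : Prop := cocycles K G W k ≤ coboundaries K G W k

end Cochains

/-! ### Removing a vertex -/

section Vertex

variable {V : Type*} [LinearOrder V] {K : Type*} [Field K] {G : SimpleGraph V}

variable (G) in
open Classical in
/-- The vertices of `W` outside the closed neighbourhood of `v`. They carry the link of `v` in the
independence complex. -/
noncomputable def nonNbrs (W : Finset V) (v : V) : Finset V :=
  W.filter fun w => w ≠ v ∧ ¬G.Adj v w

theorem mem_nonNbrs {W : Finset V} {v w : V} :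
    w ∈ nonNbrs G W v ↔ w ∈ W ∧ w ≠ v ∧ ¬G.Adj v w := by
  simp [nonNbrs]

theorem nonNbrs_subset_erase (W : Finset V) (v : V) : nonNbrs G W v ⊆ W.erase v := by
  intro w hw
  rw [mem_nonNbrs] at hw
  exact Finset.mem_erase.mpr ⟨hw.2.1, hw.1⟩

theorem isFace_erase_iff {W A : Finset V} {v : V} (hv : v ∈ W) (hA : v ∈ A) :
    IsFace G (nonNbrs G W v) (A.erase v) ↔ IsFace G W A := by
  constructor
  · rintro ⟨h1, h2⟩
    have h3 : ∀ w ∈ A, w ≠ v → w ∈ W ∧ w ≠ v ∧ ¬G.Adj v w := fun w hw hne =>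
      mem_nonNbrs.mp (h1 (Finset.mem_erase.mpr ⟨hne, hw⟩))
    refine ⟨fun w hw => ?_, fun x hx y hy hxy => ?_⟩
    · by_cases hne : w = v
      · exact hne ▸ hv
      · exact (h3 w hw hne).1
    · by_cases hxv : x = v
      · subst hxv
        exact (h3 y hy hxy.symm).2.2
      · by_cases hyv : y = v
        · subst hyv
          exact fun h => (h3 x hx hxy).2.2 h.symm
        · exact h2 (by simpa [hxv] using hx) (by simpa [hyv] using hy) hxy
  · rintro ⟨h1, h2⟩
    refine ⟨fun w hw => ?_, Set.Pairwise.mono (by simp) h2⟩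
    obtain ⟨hne, hw⟩ := Finset.mem_erase.mp hw
    exact mem_nonNbrs.mpr ⟨h1 hw, hne, h2 hA hw hne.symm⟩

theorem isFace_erase_left_iff {W A : Finset V} {v : V} :
    IsFace G (W.erase v) A ↔ IsFace G W A ∧ v ∉ A := by
  simp only [IsFace, Finset.subset_erase]
  tauto

/-- Exterior multiplication by the vertex `v`. -/
def wedge (v : V) : (Finset V → K) →ₗ[K] (Finset V → K) where
  toFun g A := if v ∈ A then insertSign v (A.erase v) • g (A.erase v) else 0
  map_add' f g := by
    funext A
    by_cases h : v ∈ A <;> simp [h]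
  map_smul' c f := by
    funext A
    by_cases h : v ∈ A
    · simp only [if_pos h, Pi.smul_apply, RingHom.id_apply]
      exact smul_comm _ _ _
    · simp [h]

theorem wedge_of_mem {v : V} {A : Finset V} (h : v ∈ A) (g : Finset V → K) :
    wedge v g A = insertSign v (A.erase v) • g (A.erase v) := if_pos h

theorem wedge_of_notMem {v : V} {A : Finset V} (h : v ∉ A) (g : Finset V → K) :
    wedge v g A = 0 := if_neg h

/-- Contraction by the vertex `v`. -/
def contract (v : V) (f : Finset V → K) : Finset V → K := fun B =>
  if v ∈ B then 0 else insertSign v B • f (insert v B)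

theorem contract_wedge {v : V} {g : Finset V → K} (hg : ∀ A, v ∈ A → g A = 0) :
    contract v (wedge v g) = g := by
  funext B
  unfold contract
  by_cases h : v ∈ B
  · rw [if_pos h, hg B h]
  · rw [if_neg h, wedge_of_mem (Finset.mem_insert_self _ _), Finset.erase_insert h, smul_smul,
      ← pow_two, Int.units_sq, one_smul]

theorem eq_zero_of_mem_cochains_nonNbrs {W : Finset V} {v : V} {k : ℤ} {g : Finset V → K}
    (hg : g ∈ cochains K G (nonNbrs G W v) k) (A : Finset V) (hA : v ∈ A) : g A = 0 := by
  by_contra h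
  exact (mem_nonNbrs.mp ((hg A h).1.1 hA)).2.1 rfl

theorem wedge_mem_cochains {W : Finset V} {v : V} (hv : v ∈ W) {k : ℤ} {g : Finset V → K}
    (hg : g ∈ cochains K G (nonNbrs G W v) (k - 1)) : wedge v g ∈ cochains K G W k := by
  intro A hA
  by_cases h : v ∈ A
  · rw [wedge_of_mem h] at hA
    have h1 : g (A.erase v) ≠ 0 := fun h0 => hA (by rw [h0, smul_zero])
    obtain ⟨h2, h3⟩ := hg _ h1
    refine ⟨(isFace_erase_iff hv h).mp h2, ?_⟩
    rw [Finset.card_erase_of_mem h] at h3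
    have := Finset.card_pos.mpr ⟨v, h⟩
    omega
  · exact absurd (wedge_of_notMem h g) hA

theorem contract_mem_cochains {W : Finset V} {v : V} (hv : v ∈ W) {k : ℤ} {f : Finset V → K}
    (hf : f ∈ cochains K G W k) : contract v f ∈ cochains K G (nonNbrs G W v) (k - 1) := by
  intro B hB
  unfold contract at hB
  split_ifs at hB with h
  · exact absurd rfl hB
  · have h1 : f (insert v B) ≠ 0 := fun h0 => hB (by rw [h0, smul_zero])
    obtain ⟨h2, h3⟩ := hf _ h1
    rw [← isFace_erase_iff hv (Finset.mem_insert_self v B), Finset.erase_insert h] at h2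
    refine ⟨h2, ?_⟩
    rw [Finset.card_insert_of_notMem h] at h3
    push_cast at h3
    omega

theorem cobd_of_mem_cochains_erase {W : Finset V} {v : V} (hv : v ∈ W) {k : ℤ} {f : Finset V → K}
    (hf : f ∈ cochains K G (W.erase v) k) :
    cobd K G W f = cobd K G (W.erase v) f + wedge v (faceRestrict K G (nonNbrs G W v) f) := by
  funext A
  rw [Pi.add_apply]
  by_cases hA : v ∈ A
  · rw [cobd_of_not_isFace (W := W.erase v) (fun h => (isFace_erase_left_iff.mp h).2 hA), zero_add,
      wedge_of_mem hA]
    by_cases h : IsFace G W A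
    · rw [cobd_of_isFace h, faceRestrict_of_isFace ((isFace_erase_iff hv hA).mpr h)]
      refine Finset.sum_eq_single_of_mem v hA fun u _ hne => ?_
      rw [cochains_eq_zero_of_not_isFace hf (fun h1 => (isFace_erase_left_iff.mp h1).2
        (Finset.mem_erase.mpr ⟨hne.symm, hA⟩)), smul_zero]
    · rw [cobd_of_not_isFace h, faceRestrict_of_not_isFace
        (fun h1 => h ((isFace_erase_iff hv hA).mp h1)), smul_zero]
  · rw [wedge_of_notMem hA, add_zero]
    by_cases h : IsFace G W A
    · rw [cobd_of_isFace h, cobd_of_isFace (isFace_erase_left_iff.mpr ⟨h, hA⟩)]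
    · rw [cobd_of_not_isFace h,
        cobd_of_not_isFace (fun h1 => h (isFace_erase_left_iff.mp h1).1)]

theorem cobd_wedge {W : Finset V} {v : V} (hv : v ∈ W) (g : Finset V → K) :
    cobd K G W (wedge v g) = -wedge v (cobd K G (nonNbrs G W v) g) := by
  funext A
  rw [Pi.neg_apply]
  by_cases hA : v ∈ A
  · rw [wedge_of_mem hA]
    by_cases h : IsFace G W A
    · rw [cobd_of_isFace h, cobd_of_isFace ((isFace_erase_iff hv hA).mpr h), Finset.smul_sum,
        ← Finset.sum_neg_distrib, ← Finset.add_sum_erase _ _ hA,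
        wedge_of_notMem (by simp), smul_zero, zero_add]
      refine Finset.sum_congr rfl fun u hu => ?_
      obtain ⟨hne, hu⟩ := Finset.mem_erase.mp hu
      have h1 : insert v ((A.erase v).erase u) = A.erase u := by
        rw [Finset.erase_right_comm]
        exact Finset.insert_erase (Finset.mem_erase.mpr ⟨hne.symm, hA⟩)
      have h2 : insert u ((A.erase v).erase u) = A.erase v :=
        Finset.insert_erase (Finset.mem_erase.mpr ⟨hne, hu⟩)
      have key := insertSign_mul_insertSign (A := (A.erase v).erase u) hne.symm (by simp) (by simp)
      rw [h1, h2] at key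
      rw [wedge_of_mem (Finset.mem_erase.mpr ⟨hne.symm, hA⟩), Finset.erase_right_comm, smul_smul,
        smul_smul, mul_comm, key, Units.neg_smul, mul_comm]
    · rw [cobd_of_not_isFace h, cobd_of_not_isFace
        (fun h1 => h ((isFace_erase_iff hv hA).mp h1)), smul_zero, neg_zero]
  · rw [wedge_of_notMem hA, neg_zero]
    by_cases h : IsFace G W A
    · rw [cobd_of_isFace h]
      exact Finset.sum_eq_zero fun u _ => by
        rw [wedge_of_notMem (fun h1 => hA (Finset.mem_of_mem_erase h1)), smul_zero]
    · exact cobd_of_not_isFace h _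

end Vertex

section VertexSequence

variable {V : Type*} [LinearOrder V] {K : Type*} [Field K] {G : SimpleGraph V}

theorem faceRestrict_add_wedge_contract {W : Finset V} {k : ℤ} {f : Finset V → K} (v : V)
    (hf : f ∈ cochains K G W k) :
    faceRestrict K G (W.erase v) f + wedge v (contract v f) = f := by
  funext A
  rw [Pi.add_apply]
  by_cases hA : v ∈ A
  · rw [faceRestrict_of_not_isFace (fun h => (isFace_erase_left_iff.mp h).2 hA), zero_add,
      wedge_of_mem hA, contract, if_neg (by simp), Finset.insert_erase hA, smul_smul,
      ← pow_two, Int.units_sq, one_smul]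
  · rw [wedge_of_notMem hA, add_zero]
    by_cases h : IsFace G W A
    · rw [faceRestrict_of_isFace (isFace_erase_left_iff.mpr ⟨h, hA⟩)]
    · rw [faceRestrict_of_not_isFace (fun h1 => h (isFace_erase_left_iff.mp h1).1),
        cochains_eq_zero_of_not_isFace hf h]

theorem add_wedge_eq_zero_iff {W : Finset V} {v : V} {k l : ℤ} {x y : Finset V → K}
    (hx : x ∈ cochains K G (W.erase v) k) (hy : y ∈ cochains K G (nonNbrs G W v) l) :
    x + wedge v y = 0 ↔ x = 0 ∧ y = 0 := by
  constructor
  · intro h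
    have h1 : x = 0 := by
      funext A
      by_cases hA : v ∈ A
      · exact cochains_eq_zero_of_not_isFace hx fun h => (isFace_erase_left_iff.mp h).2 hA
      · have := congrFun h A
        rwa [Pi.add_apply, wedge_of_notMem hA, add_zero] at this
    refine ⟨h1, ?_⟩
    rw [h1, zero_add] at h
    rw [← contract_wedge (eq_zero_of_mem_cochains_nonNbrs hy), h]
    funext B
    simp [contract]
  · rintro ⟨rfl, rfl⟩
    simp

/-- The cochain complex on `W` is the mapping cone of the restriction from the complement of `v`
to the link of `v`. -/
theorem cobd_add_wedge {W : Finset V} {v : V} (hv : v ∈ W) {k : ℤ} {x : Finset V → K}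
    (hx : x ∈ cochains K G (W.erase v) k) (y : Finset V → K) :
    cobd K G W (x + wedge v y) = cobd K G (W.erase v) x +
      wedge v (faceRestrict K G (nonNbrs G W v) x - cobd K G (nonNbrs G W v) y) := by
  rw [map_add, cobd_of_mem_cochains_erase hv hx, cobd_wedge hv, map_sub]
  abel

theorem add_wedge_mem_cocycles_iff {W : Finset V} {v : V} (hv : v ∈ W) {k : ℤ}
    {x y : Finset V → K} (hx : x ∈ cochains K G (W.erase v) k)
    (hy : y ∈ cochains K G (nonNbrs G W v) (k - 1)) :
    x + wedge v y ∈ cocycles K G W k ↔ cobd K G (W.erase v) x = 0 ∧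
      faceRestrict K G (nonNbrs G W v) x = cobd K G (nonNbrs G W v) y := by
  have h1 : x + wedge v y ∈ cochains K G W k :=
    add_mem (cochains_mono (Finset.erase_subset _ _) k hx) (wedge_mem_cochains hv hy)
  have h2 : cobd K G (nonNbrs G W v) y ∈ cochains K G (nonNbrs G W v) k := by
    have := cobd_mem_cochains hy
    rwa [sub_add_cancel] at this
  rw [mem_cocycles, and_iff_right h1, cobd_add_wedge hv hx,
    add_wedge_eq_zero_iff (cobd_mem_cochains hx) (sub_mem (faceRestrict_mem_cochains hx) h2),
    sub_eq_zero]

/-- Exactness at the cohomology of `W` of the long exact sequence of a vertex. -/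
theorem Acyclic.of_vertex {W : Finset V} {v : V} (hv : v ∈ W) {k : ℤ}
    (h0 : Acyclic K G (W.erase v) k) (h1 : Acyclic K G (nonNbrs G W v) (k - 1)) :
    Acyclic K G W k := by
  intro f hf
  have hx : faceRestrict K G (W.erase v) f ∈ cochains K G (W.erase v) k :=
    faceRestrict_mem_cochains hf.1
  have hy := contract_mem_cochains hv hf.1
  have hf' := faceRestrict_add_wedge_contract v hf.1
  rw [← hf'] at hf ⊢
  set x := faceRestrict K G (W.erase v) f
  set y := contract v f
  obtain ⟨hDx, hxy⟩ := (add_wedge_mem_cocycles_iff hv hx hy).mp hf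
  obtain ⟨g, hg, hgx⟩ := h0 ⟨hx, hDx⟩
  have hyc : faceRestrict K G (nonNbrs G W v) g - y ∈ cocycles K G (nonNbrs G W v) (k - 1) := by
    refine ⟨sub_mem (faceRestrict_mem_cochains hg) hy, ?_⟩
    change cobd K G _ _ = 0
    rw [map_sub, cobd_faceRestrict (nonNbrs_subset_erase W v), hgx, hxy, sub_self]
  obtain ⟨e, he, hey⟩ := h1 hyc
  refine ⟨g + wedge v e, add_mem (cochains_mono (Finset.erase_subset _ _) _ hg)
    (wedge_mem_cochains hv he), ?_⟩
  rw [cobd_add_wedge hv hg, hgx, hey]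
  simp

/-- The independence complex is a cone if the graph has an isolated vertex. -/
theorem acyclic_of_isolated {W : Finset V} {u : V} (hu : u ∈ W) (h : ∀ w ∈ W, ¬G.Adj u w) (k : ℤ) :
    Acyclic K G W k := by
  have hL : nonNbrs G W u = W.erase u := by
    ext w
    rw [mem_nonNbrs, Finset.mem_erase]
    exact ⟨fun h => ⟨h.2.1, h.1⟩, fun h1 => ⟨h1.2, h1.1, h w h1.2⟩⟩
  intro f hf
  have hx : faceRestrict K G (W.erase u) f ∈ cochains K G (W.erase u) k :=
    faceRestrict_mem_cochains hf.1
  have hy := contract_mem_cochains hu hf.1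
  have hf' := faceRestrict_add_wedge_contract u hf.1
  rw [← hf'] at hf ⊢
  obtain ⟨-, hxy⟩ := (add_wedge_mem_cocycles_iff hu hx hy).mp hf
  rw [hL] at hxy hy
  rw [faceRestrict_eq_self hx] at hxy
  refine ⟨contract u f, cochains_mono (Finset.erase_subset _ _) _ hy, ?_⟩
  rw [cobd_of_mem_cochains_erase hu hy, hL, faceRestrict_eq_self hy, hxy]

theorem acyclic_of_card_lt_zero (W : Finset V) {k : ℤ} (hk : k < 0) : Acyclic K G W k := by
  intro f hf
  have : f = 0 := by
    funext A
    exact cochains_eq_zero_of_card hf.1 (by omega)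
  rw [this]
  exact zero_mem _

theorem faceRestrict_erase_wedge (W : Finset V) (v : V) (y : Finset V → K) :
    faceRestrict K G (W.erase v) (wedge v y) = 0 := by
  funext A
  by_cases h : IsFace G (W.erase v) A
  · rw [faceRestrict_of_isFace h, wedge_of_notMem (isFace_erase_left_iff.mp h).2, Pi.zero_apply]
  · exact faceRestrict_of_not_isFace h _

end VertexSequence

section Dimensions

theorem finrank_eq_map_add_inf_ker {K E F : Type*} [Field K] [AddCommGroup E] [Module K E]
    [AddCommGroup F] [Module K F] [FiniteDimensional K E] (P : Submodule K E) (φ : E →ₗ[K] F) :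
    Module.finrank K P =
      Module.finrank K (P.map φ) + Module.finrank K (P ⊓ LinearMap.ker φ : Submodule K E) := by
  rw [← LinearMap.finrank_range_add_finrank_ker (φ.domRestrict P), LinearMap.range_domRestrict,
    LinearMap.ker_domRestrict]
  congr 1
  have h : (P ⊓ LinearMap.ker φ).submoduleOf P = (LinearMap.ker φ).submoduleOf P := by
    simp [Submodule.submoduleOf]
  rw [← (Submodule.submoduleOfEquivOfLe inf_le_left).finrank_eq, h]
  rfl

variable {V : Type*} [Finite V] {K : Type*} [Field K] {G : SimpleGraph V}

theorem finrank_cochains_eq_card (W : Finset V) (k : ℤ) :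
    Module.finrank K (cochains K G W k) =
      Nat.card {A : Finset V // IsFace G W A ∧ (A.card : ℤ) = k} := by
  classical
  have := Fintype.ofFinite V
  have e : cochains K G W k ≃ₗ[K] ({A : Finset V // IsFace G W A ∧ (A.card : ℤ) = k} → K) :=
    { toFun := fun f A => f.1 A.1
      map_add' := fun _ _ => rfl
      map_smul' := fun _ _ => rfl
      invFun := fun g => ⟨fun A => if h : IsFace G W A ∧ (A.card : ℤ) = k then g ⟨A, h⟩ else 0,
        fun A hA => by
          by_contra h
          exact hA (dif_neg h)⟩
      left_inv := fun f => by
        ext A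
        by_cases h : IsFace G W A ∧ (A.card : ℤ) = k
        · simp only [dif_pos h]
        · simp only [dif_neg h]
          by_contra h0
          exact h (f.2 A (Ne.symm h0))
      right_inv := fun g => by
        funext A
        simp only [dif_pos A.2] }
  rw [e.finrank_eq, Module.finrank_fintype_fun_eq_card, Nat.card_eq_fintype_card]

variable [LinearOrder V]

theorem finrank_map_wedge {W : Finset V} {v : V} {k : ℤ} {P : Submodule K (Finset V → K)}
    (hP : P ≤ cochains K G (nonNbrs G W v) k) :
    Module.finrank K (P.map (wedge v)) = Module.finrank K P := by
  rw [finrank_eq_map_add_inf_ker P (wedge v), Nat.left_eq_add]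
  have : P ⊓ LinearMap.ker (wedge v) = ⊥ := by
    rw [eq_bot_iff]
    rintro y ⟨hy, hy0⟩
    have h0 : (0 : Finset V → K) ∈ cochains K G (W.erase v) k := zero_mem _
    exact ((add_wedge_eq_zero_iff h0 (hP hy)).mp (by rw [zero_add]; exact hy0)).2
  rw [this, finrank_bot]

theorem finrank_cochains_vertex {W : Finset V} {v : V} (hv : v ∈ W) (k : ℤ) :
    Module.finrank K (cochains K G W k) = Module.finrank K (cochains K G (W.erase v) k) +
      Module.finrank K (cochains K G (nonNbrs G W v) (k - 1)) := by
  rw [finrank_eq_map_add_inf_ker _ (faceRestrict K G (W.erase v))]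
  congr 1
  · refine congrArg (fun P : Submodule K (Finset V → K) => Module.finrank K P) ?_
    apply le_antisymm
    · rintro _ ⟨f, hf, rfl⟩
      exact faceRestrict_mem_cochains hf
    · intro f hf
      exact ⟨f, cochains_mono (Finset.erase_subset _ _) k hf, faceRestrict_eq_self hf⟩
  · rw [← finrank_map_wedge (le_refl (cochains K G (nonNbrs G W v) (k - 1)))]
    refine congrArg (fun P : Submodule K (Finset V → K) => Module.finrank K P) ?_
    apply le_antisymm
    · rintro f ⟨hf, hf0⟩
      refine ⟨contract v f, contract_mem_cochains hv hf, ?_⟩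
      replace hf0 : faceRestrict K G (W.erase v) f = 0 := hf0
      have := faceRestrict_add_wedge_contract v hf
      rwa [hf0, zero_add] at this
    · rintro _ ⟨y, hy, rfl⟩
      exact ⟨wedge_mem_cochains hv hy, faceRestrict_erase_wedge W v y⟩

/-- If the restriction from the complement of `v` to the link of `v` is zero in cohomology,
because it factors through the acyclic complex on `M`, the cocycles on `W` split. -/
theorem finrank_cocycles_vertex {W M : Finset V} {v : V} (hv : v ∈ W) {k : ℤ}
    (hLM : nonNbrs G W v ⊆ M) (hMW : M ⊆ W.erase v) (hM : Acyclic K G M k) :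
    Module.finrank K (cocycles K G W k) = Module.finrank K (cocycles K G (W.erase v) k) +
      Module.finrank K (cocycles K G (nonNbrs G W v) (k - 1)) := by
  rw [finrank_eq_map_add_inf_ker _ (faceRestrict K G (W.erase v))]
  congr 1
  · refine congrArg (fun P : Submodule K (Finset V → K) => Module.finrank K P) ?_
    apply le_antisymm
    · rintro _ ⟨f, ⟨hf, hf0⟩, rfl⟩
      refine ⟨faceRestrict_mem_cochains hf, ?_⟩
      replace hf0 : cobd K G W f = 0 := hf0
      change cobd K G _ _ = 0
      rw [cobd_faceRestrict (Finset.erase_subset _ _), hf0, map_zero]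
    · rintro x ⟨hx, hx0⟩
      have h1 : faceRestrict K G M x ∈ cocycles K G M k := by
        refine ⟨faceRestrict_mem_cochains hx, ?_⟩
        replace hx0 : cobd K G (W.erase v) x = 0 := hx0
        change cobd K G _ _ = 0
        rw [cobd_faceRestrict hMW, hx0, map_zero]
      obtain ⟨g, hg, hgx⟩ := hM h1
      have hg' : faceRestrict K G (nonNbrs G W v) g ∈ cochains K G (nonNbrs G W v) (k - 1) :=
        faceRestrict_mem_cochains hg
      refine ⟨x + wedge v (faceRestrict K G (nonNbrs G W v) g),
        (add_wedge_mem_cocycles_iff hv hx hg').mpr ⟨hx0, ?_⟩, ?_⟩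
      · rw [cobd_faceRestrict hLM, hgx, faceRestrict_faceRestrict hLM]
      · rw [map_add, faceRestrict_eq_self hx, faceRestrict_erase_wedge, add_zero]
  · have hle : cocycles K G (nonNbrs G W v) (k - 1) ≤ cochains K G (nonNbrs G W v) (k - 1) :=
      inf_le_left
    rw [← finrank_map_wedge hle]
    refine congrArg (fun P : Submodule K (Finset V → K) => Module.finrank K P) ?_
    have h0 : (0 : Finset V → K) ∈ cochains K G (W.erase v) k := zero_mem _
    apply le_antisymm
    · rintro f ⟨hf, hf0⟩
      have hy := contract_mem_cochains hv hf.1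
      replace hf0 : faceRestrict K G (W.erase v) f = 0 := hf0
      have := faceRestrict_add_wedge_contract v hf.1
      rw [hf0] at this
      rw [← this] at hf
      have h2 := ((add_wedge_mem_cocycles_iff hv h0 hy).mp hf).2
      rw [zero_add] at this
      exact ⟨contract v f, ⟨hy, h2.symm.trans (map_zero _)⟩, this⟩
    · rintro _ ⟨y, ⟨hy, hy0⟩, rfl⟩
      refine ⟨?_, faceRestrict_erase_wedge W v y⟩
      rw [← zero_add (wedge v y)]
      refine (add_wedge_mem_cocycles_iff hv h0 hy).mpr ⟨map_zero _, ?_⟩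
      rw [map_zero]
      exact (LinearMap.mem_ker.mp hy0).symm

theorem finrank_cochains_eq (W : Finset V) (k : ℤ) :
    Module.finrank K (cochains K G W k) = Module.finrank K (coboundaries K G W (k + 1)) +
      Module.finrank K (cocycles K G W k) := by
  rw [finrank_eq_map_add_inf_ker _ (cobd K G W), coboundaries, cocycles, add_sub_cancel_right]

theorem cohDim_add_finrank (W : Finset V) (k : ℤ) :
    cohDim K G W k + Module.finrank K (coboundaries K G W k) =
      Module.finrank K (cocycles K G W k) :=
  quotDim_add_finrank (coboundaries_le_cocycles W k)

theorem Acyclic.cohDim_eq_zero {W : Finset V} {k : ℤ} (h : Acyclic K G W k) :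
    cohDim K G W k = 0 := by
  have h1 := cohDim_add_finrank (K := K) (G := G) W k
  rw [le_antisymm h (coboundaries_le_cocycles W k)] at h1
  omega

/-- The long exact sequence of a vertex splits in degree `k` if the restrictions from the
complement of `v` to the link of `v` vanish in the two relevant degrees. -/
theorem cohDim_vertex {W M M' : Finset V} {v : V} (hv : v ∈ W) {k : ℤ}
    (hLM : nonNbrs G W v ⊆ M) (hMW : M ⊆ W.erase v) (hM : Acyclic K G M k)
    (hLM' : nonNbrs G W v ⊆ M') (hMW' : M' ⊆ W.erase v) (hM' : Acyclic K G M' (k - 1)) :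
    cohDim K G W k = cohDim K G (W.erase v) k + cohDim K G (nonNbrs G W v) (k - 1) := by
  have h1 := finrank_cocycles_vertex hv hLM hMW hM
  have h2 := finrank_cocycles_vertex hv hLM' hMW' hM'
  have c1 := finrank_cochains_vertex (K := K) (G := G) hv (k - 1)
  have a1 := cohDim_add_finrank (K := K) (G := G) W k
  have a2 := cohDim_add_finrank (K := K) (G := G) (W.erase v) k
  have a3 := cohDim_add_finrank (K := K) (G := G) (nonNbrs G W v) (k - 1)
  have b1 := finrank_cochains_eq (K := K) (G := G) W (k - 1)
  have b2 := finrank_cochains_eq (K := K) (G := G) (W.erase v) (k - 1)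
  have b3 := finrank_cochains_eq (K := K) (G := G) (nonNbrs G W v) (k - 1 - 1)
  rw [sub_add_cancel] at b1 b2 b3
  omega

end Dimensions

/-! ### Vertices in special position -/

section Rules

variable {V : Type*} {K : Type*} [Field K] {G : SimpleGraph V}

variable (G) in
open Classical in
/-- The neighbours of `v` in `W`. -/
noncomputable def nbrs (W : Finset V) (v : V) : Finset V := W.filter fun w => G.Adj v w

theorem mem_nbrs {W : Finset V} {v w : V} : w ∈ nbrs G W v ↔ w ∈ W ∧ G.Adj v w := by
  simp [nbrs]

theorem nbrs_subset (W : Finset V) (v : V) : nbrs G W v ⊆ W := fun _ h => (mem_nbrs.mp h).1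

variable [LinearOrder V]

theorem card_nonNbrs {W : Finset V} {v : V} (hv : v ∈ W) :
    (nonNbrs G W v).card + (nbrs G W v).card + 1 = W.card := by
  have h1 : nonNbrs G W v ∪ nbrs G W v = W.erase v := by
    ext w
    rw [Finset.mem_union, mem_nonNbrs, mem_nbrs, Finset.mem_erase]
    constructor
    · rintro (h | h)
      · exact ⟨h.2.1, h.1⟩
      · exact ⟨h.2.ne', h.1⟩
    · rintro ⟨h1, h2⟩
      by_cases h : G.Adj v w
      · exact Or.inr ⟨h2, h⟩
      · exact Or.inl ⟨h2, h1, h⟩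
  have h2 : Disjoint (nonNbrs G W v) (nbrs G W v) := Finset.disjoint_left.mpr fun w h h' =>
    (mem_nonNbrs.mp h).2.2 (mem_nbrs.mp h').2
  rw [← Finset.card_union_of_disjoint h2, h1, Finset.card_erase_add_one hv]

theorem nonNbrs_subset (W : Finset V) (v : V) : nonNbrs G W v ⊆ W :=
  (nonNbrs_subset_erase W v).trans (Finset.erase_subset _ _)

theorem card_nbrs_le_add {W : Finset V} {v w : V} (hw : w ∈ nonNbrs G W v) :
    (nbrs G W w).card ≤ (nbrs G (nonNbrs G W v) w).card + (nbrs G (nbrs G W v) w).card := by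
  refine le_trans (Finset.card_le_card fun x hx => ?_) (Finset.card_union_le _ _)
  obtain ⟨hx1, hx2⟩ := mem_nbrs.mp hx
  have hxv : x ≠ v := by
    rintro rfl
    exact (mem_nonNbrs.mp hw).2.2 hx2.symm
  rw [Finset.mem_union, mem_nbrs, mem_nbrs, mem_nonNbrs, mem_nbrs]
  by_cases h : G.Adj v x
  · exact Or.inr ⟨⟨hx1, h⟩, hx2⟩
  · exact Or.inl ⟨⟨hx1, hxv, h⟩, hx2⟩

theorem card_nbrs_nonNbrs_lt {W : Finset V} {v w : V} (hv : v ∈ W) (hw : w ∈ nbrs G W v) :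
    (nbrs G (nonNbrs G W v) w).card < (nbrs G W w).card := by
  refine Finset.card_lt_card (Finset.ssubset_iff_of_subset (fun x hx => ?_) |>.mpr ⟨v, ?_, ?_⟩)
  · rw [mem_nbrs, mem_nonNbrs] at hx
    exact mem_nbrs.mpr ⟨hx.1.1, hx.2⟩
  · exact mem_nbrs.mpr ⟨hv, (mem_nbrs.mp hw).2.symm⟩
  · rw [mem_nbrs, mem_nonNbrs]
    exact fun h => h.1.2.1 rfl

theorem card_nonNbrs_mul_le {W : Finset V} {v : V} {m n : ℕ}
    (hm : ∀ w ∈ nonNbrs G W v, m ≤ (nbrs G (nbrs G W v) w).card)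
    (hn : ∀ w ∈ nbrs G W v, (nbrs G (nonNbrs G W v) w).card ≤ n) :
    (nonNbrs G W v).card * m ≤ (nbrs G W v).card * n := by
  classical
  refine Finset.card_mul_le_card_mul G.Adj (fun w hw => ?_) (fun w hw => ?_)
  · convert hm w hw
    ext x
    simp [Finset.bipartiteAbove, mem_nbrs]
  · convert hn w hw
    ext x
    simp [Finset.bipartiteBelow, mem_nbrs, G.adj_comm]

theorem acyclic_erase_of_leaf {W : Finset V} {u v : V} (hu : u ∈ W) (huv : G.Adj u v)
    (h : ∀ w ∈ W, G.Adj u w → w = v) (k : ℤ) : Acyclic K G (W.erase v) k :=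
  acyclic_of_isolated (Finset.mem_erase.mpr ⟨huv.ne, hu⟩) (fun w hw hadj =>
    (Finset.mem_erase.mp hw).1 (h w (Finset.mem_erase.mp hw).2 hadj)) k

section

variable [Finite V] {W : Finset V} {u v : V} {k : ℤ}

theorem cohDim_erase_of_acyclic (hv : v ∈ W) (h0 : Acyclic K G (nonNbrs G W v) k)
    (h1 : Acyclic K G (nonNbrs G W v) (k - 1)) :
    cohDim K G W k = cohDim K G (W.erase v) k := by
  rw [cohDim_vertex hv subset_rfl (nonNbrs_subset_erase W v) h0 subset_rfl
    (nonNbrs_subset_erase W v) h1, h1.cohDim_eq_zero, add_zero]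

/-- If `v` is the only neighbour of `u`, then the independence complex is a suspension of the
link of `v`. -/
theorem cohDim_of_leaf (hu : u ∈ W) (hv : v ∈ W) (huv : G.Adj u v)
    (h : ∀ w ∈ W, G.Adj u w → w = v) (k : ℤ) :
    cohDim K G W k = cohDim K G (nonNbrs G W v) (k - 1) := by
  rw [cohDim_vertex hv (nonNbrs_subset_erase W v) subset_rfl (acyclic_erase_of_leaf hu huv h k)
    (nonNbrs_subset_erase W v) subset_rfl (acyclic_erase_of_leaf hu huv h (k - 1)),
    (acyclic_erase_of_leaf hu huv h k).cohDim_eq_zero, zero_add]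

/-- If every neighbour of `u` is a neighbour of `v`, then the link of `v` is a cone with apex
`u`. -/
theorem cohDim_erase_of_nbrs_subset (hu : u ∈ W) (hv : v ∈ W) (hne : u ≠ v) (huv : ¬G.Adj u v)
    (h : ∀ w ∈ W, G.Adj u w → G.Adj v w) (k : ℤ) :
    cohDim K G W k = cohDim K G (W.erase v) k := by
  have key : ∀ j, Acyclic K G (nonNbrs G W v) j := acyclic_of_isolated
    (mem_nonNbrs.mpr ⟨hu, hne, fun h => huv h.symm⟩) fun w hw hadj =>
      (mem_nonNbrs.mp hw).2.2 (h w (mem_nonNbrs.mp hw).1 hadj)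
  exact cohDim_erase_of_acyclic hv (key k) (key (k - 1))

/-- If `u` is a neighbour of `v` and the closed neighbourhood of `u` is contained in that of `v`,
then the link of `v` is contained in a cone with apex `u`. -/
theorem cohDim_of_closed_nbrs_subset (hu : u ∈ W) (hv : v ∈ W) (huv : G.Adj u v)
    (h : ∀ w ∈ W, G.Adj u w → w = v ∨ G.Adj v w) (k : ℤ) :
    cohDim K G W k = cohDim K G (W.erase v) k + cohDim K G (nonNbrs G W v) (k - 1) := by
  have key : ∀ j, Acyclic K G (insert u (nonNbrs G W v)) j := by
    refine acyclic_of_isolated (Finset.mem_insert_self _ _) fun w hw hadj => ?_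
    rcases Finset.mem_insert.mp hw with rfl | hw
    · exact G.loopless.irrefl _ hadj
    · obtain ⟨h1, h2, h3⟩ := mem_nonNbrs.mp hw
      exact (h w h1 hadj).elim h2 h3
  have hM : insert u (nonNbrs G W v) ⊆ W.erase v :=
    Finset.insert_subset (Finset.mem_erase.mpr ⟨huv.ne, hu⟩) (nonNbrs_subset_erase W v)
  exact cohDim_vertex hv (Finset.subset_insert _ _) hM (key k) (Finset.subset_insert _ _) hM
    (key (k - 1))

end

/-! ### Vanishing -/

theorem acyclic_zero {W : Finset V} (hW : W.Nonempty) : Acyclic K G W 0 := by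
  obtain ⟨v, hv⟩ := hW
  intro f hf
  have h0 : f = 0 := by
    funext A
    by_cases hA : A = ∅
    · subst hA
      have hface : IsFace G W {v} := ⟨by simpa using hv, by simp [SimpleGraph.IsIndepSet]⟩
      have h1 := congrFun (LinearMap.mem_ker.mp (Submodule.mem_inf.mp hf).2) {v}
      rw [cobd_of_isFace hface] at h1
      simpa [insertSign] using h1
    · refine cochains_eq_zero_of_card hf.1 ?_
      have := Finset.card_pos.mpr (Finset.nonempty_iff_ne_empty.mpr hA)
      omega
  rw [h0]
  exact zero_mem _

/-- The cohomology in dimension `k - 1` vanishes on fewer than `2 * k` vertices: removing a vertex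
with a neighbour leaves at most `2 * k - 2` vertices, and its link has at least two vertices fewer
than `W`. -/
theorem acyclic_of_card_lt {W : Finset V} {k : ℤ} (h : (W.card : ℤ) < 2 * k) :
    Acyclic K G W k := by
  induction hn : W.card using Nat.strong_induction_on generalizing W k with
  | _ n ih =>
    subst hn
    rcases W.eq_empty_or_nonempty with rfl | ⟨v, hv⟩
    · intro f hf
      have h0 : f = 0 := by
        funext A
        by_contra hA
        obtain ⟨h1, h2⟩ := hf.1 A hA
        have := Finset.card_le_card h1.1
        simp at h this
        subst this
        simp at h2
        omega
      rw [h0]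
      exact zero_mem _
    · by_cases hiso : ∀ w ∈ W, ¬G.Adj v w
      · exact acyclic_of_isolated hv hiso k
      · push Not at hiso
        obtain ⟨w, hw, hadj⟩ := hiso
        have h1 := card_nonNbrs (G := G) hv
        have h2 := Finset.card_pos.mpr ⟨w, mem_nbrs.mpr ⟨hw, hadj⟩⟩
        have h3 := Finset.card_erase_add_one hv
        exact Acyclic.of_vertex hv (ih _ (by omega) (by omega) rfl)
          (ih _ (by omega) (by omega) rfl)

/-- With `2 * k` vertices, cohomology in dimension `k - 1` is only possible for a perfect matching
(whose independence complex is the boundary of a cross-polytope). -/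
theorem acyclic_of_card_eq {W : Finset V} {k : ℤ} (h : (W.card : ℤ) = 2 * k) {v : V} (hv : v ∈ W)
    (hdeg : (nbrs G W v).card ≠ 1) : Acyclic K G W k := by
  by_cases h0 : (nbrs G W v).card = 0
  · refine acyclic_of_isolated hv (fun w hw hadj => ?_) k
    have := Finset.card_pos.mpr ⟨w, mem_nbrs.mpr ⟨hw, hadj⟩⟩
    omega
  · have h1 := card_nonNbrs (G := G) hv
    have h3 := Finset.card_erase_add_one hv
    exact Acyclic.of_vertex hv (acyclic_of_card_lt (by omega)) (acyclic_of_card_lt (by omega))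

/-! ### Cohomology in dimension zero -/

theorem mem_cocycles_one_iff {W : Finset V} {f : Finset V → K} (hf : f ∈ cochains K G W 1) :
    f ∈ cocycles K G W 1 ↔ ∀ u ∈ W, ∀ w ∈ W, ¬G.Adj u w → f {u} = f {w} := by
  have key : ∀ u w, u < w → IsFace G W {u, w} → cobd K G W f {u, w} = f {w} - f {u} := by
    intro u w huw hface
    have e1 : ({u, w} : Finset V).erase u = {w} := by
      ext x
      simp only [Finset.mem_erase, Finset.mem_insert, Finset.mem_singleton]
      constructor
      · tauto
      · rintro rfl
        exact ⟨huw.ne', Or.inr rfl⟩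
    have e2 : ({u, w} : Finset V).erase w = {u} := by
      ext x
      simp only [Finset.mem_erase, Finset.mem_insert, Finset.mem_singleton]
      constructor
      · tauto
      · rintro rfl
        exact ⟨huw.ne, Or.inl rfl⟩
    rw [cobd_of_isFace hface, Finset.sum_pair huw.ne, e1, e2]
    simp [insertSign, Finset.filter_singleton, huw, huw.not_gt, sub_eq_add_neg]
  have hface : ∀ u ∈ W, ∀ w ∈ W, ¬G.Adj u w → IsFace G W {u, w} := by
    intro u hu w hw h
    refine ⟨by simp [Finset.insert_subset_iff, hu, hw], ?_⟩
    have h' : ¬G.Adj w u := fun h1 => h h1.symm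
    intro x hx y hy hxy
    simp only [Finset.coe_insert, Finset.coe_singleton, Set.mem_insert_iff,
      Set.mem_singleton_iff] at hx hy
    rcases hx with rfl | rfl <;> rcases hy with rfl | rfl <;> tauto
  constructor
  · rintro ⟨-, h⟩ u hu w hw hadj
    replace h : cobd K G W f = 0 := h
    rcases lt_trichotomy u w with huw | rfl | huw
    · have := key u w huw (hface u hu w hw hadj)
      rw [h, Pi.zero_apply] at this
      exact (sub_eq_zero.mp this.symm).symm
    · rfl
    · have := key w u huw (hface w hw u hu fun h1 => hadj h1.symm)
      rw [h, Pi.zero_apply] at this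
      exact sub_eq_zero.mp this.symm
  · intro h
    refine ⟨hf, ?_⟩
    change cobd K G W f = 0
    funext A
    by_contra hA
    obtain ⟨h1, h2⟩ := cobd_mem_cochains hf A hA
    obtain ⟨u, w, hne, rfl⟩ := Finset.card_eq_two.mp (by omega : A.card = 2)
    have hu : u ∈ W := h1.1 (by simp)
    have hw : w ∈ W := h1.1 (by simp)
    have hadj : ¬G.Adj u w := h1.2 (by simp) (by simp) hne
    rcases lt_or_gt_of_ne hne with huw | huw
    · rw [key u w huw h1, h u hu w hw hadj, sub_self] at hA
      exact hA rfl
    · rw [Finset.pair_comm] at hA h1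
      rw [key w u huw h1, h u hu w hw hadj, sub_self] at hA
      exact hA rfl

/-- The reduced cohomology in dimension zero vanishes if the independence complex is connected;
connectedness is expressed by functions that are locally constant. -/
theorem acyclic_one_of_connected {W : Finset V} {a : V}
    (h : ∀ f : V → K, (∀ u ∈ W, ∀ w ∈ W, ¬G.Adj u w → f u = f w) → ∀ u ∈ W, f u = f a) :
    Acyclic K G W 1 := by
  intro f hf
  have h1 := h (fun u => f {u}) ((mem_cocycles_one_iff hf.1).mp hf)
  refine ⟨fun A => if A = ∅ then f {a} else 0, fun A hA => ?_, ?_⟩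
  · have hA : A = ∅ := by
      by_contra h0
      exact hA (if_neg h0)
    subst hA
    exact ⟨⟨by simp, by simp [SimpleGraph.IsIndepSet]⟩, by simp⟩
  · have hg : cobd K G W (fun A => if A = ∅ then f {a} else 0) ∈ cochains K G W (0 + 1) := by
      refine cobd_mem_cochains fun A hA => ?_
      have hA : A = ∅ := by
        by_contra h0
        exact hA (if_neg h0)
      subst hA
      exact ⟨⟨by simp, by simp [SimpleGraph.IsIndepSet]⟩, by simp⟩
    rw [zero_add] at hg
    funext A
    by_cases hA : IsFace G W A ∧ (A.card : ℤ) = 1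
    · obtain ⟨u, rfl⟩ := Finset.card_eq_one.mp (by omega : A.card = 1)
      have hu : u ∈ W := hA.1.1 (by simp)
      rw [cobd_of_isFace hA.1]
      simpa [insertSign] using (h1 u hu).symm
    · have e1 : f A = 0 := by
        by_contra h0
        exact hA (hf.1 A h0)
      rw [e1]
      by_contra h0
      exact hA (hg A h0)

/-- The cocycles of dimension zero are the functions on the set of connected components of the
independence complex, whose edges are the pairs of non-adjacent vertices. -/
theorem finrank_cocycles_one [Finite V] (W : Finset V) :
    Module.finrank K (cocycles K G W 1) = Nat.card (Quot fun u w : W => ¬G.Adj u w) := by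
  have hsingle : ∀ A : Finset V, A.card = 1 → ∃ u, A = {u} := fun A => Finset.card_eq_one.mp
  let F : (Quot (fun u w : W => ¬G.Adj u w) → K) → Finset V → K := fun g A =>
    if h : ∃ u : W, A = {u.1} then g (Quot.mk _ h.choose) else 0
  have hF : ∀ g (u : W), F g {u.1} = g (Quot.mk _ u) := by
    intro g u
    have h : ∃ w : W, ({u.1} : Finset V) = {w.1} := ⟨u, rfl⟩
    have h1 : F g {u.1} = g (Quot.mk _ h.choose) := dif_pos h
    have h2 := h.choose_spec
    rw [Finset.singleton_inj] at h2
    rw [h1, ← Subtype.ext h2]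
  have hFc : ∀ g, F g ∈ cochains K G W 1 := by
    intro g A hA
    have h : ∃ u : W, A = {u.1} := by
      by_contra h
      exact hA (dif_neg h)
    obtain ⟨u, rfl⟩ := h
    exact ⟨⟨by simp, by simp [SimpleGraph.IsIndepSet]⟩, by simp⟩
  have e : cocycles K G W 1 ≃ₗ[K] (Quot (fun u w : W => ¬G.Adj u w) → K) :=
    { toFun := fun f => Quot.lift (fun u => f.1 {u.1}) fun u w h =>
        (mem_cocycles_one_iff f.2.1).mp f.2 u u.2 w w.2 h
      map_add' := fun f g => by
        funext q
        induction q using Quot.ind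
        rfl
      map_smul' := fun c f => by
        funext q
        induction q using Quot.ind
        rfl
      invFun := fun g => ⟨F g, (mem_cocycles_one_iff (hFc g)).mpr fun u hu w hw h => by
        rw [hF g ⟨u, hu⟩, hF g ⟨w, hw⟩]
        exact congrArg g (Quot.sound h)⟩
      left_inv := fun f => by
        ext A
        by_cases hA : IsFace G W A ∧ (A.card : ℤ) = 1
        · obtain ⟨u, rfl⟩ := hsingle A (by omega)
          exact hF (Quot.lift (fun u : W => f.1 {u.1}) fun u w h =>
            (mem_cocycles_one_iff f.2.1).mp f.2 u u.2 w w.2 h) ⟨u, hA.1.1 (by simp)⟩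
        · have h1 : f.1 A = 0 := by
            by_contra h0
            exact hA (f.2.1 A h0)
          rw [h1]
          by_contra h0
          exact hA (hFc (Quot.lift (fun u : W => f.1 {u.1}) fun u w h =>
            (mem_cocycles_one_iff f.2.1).mp f.2 u u.2 w w.2 h) A h0)
      right_inv := fun g => by
        funext q
        induction q using Quot.ind
        exact hF g _ }
  have : Fintype (Quot fun u w : W => ¬G.Adj u w) := Fintype.ofFinite _
  rw [e.finrank_eq, Module.finrank_fintype_fun_eq_card, Nat.card_eq_fintype_card]

end Rules

/-! ### Independence of the field -/

section FieldIndependence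

variable {V : Type*} [LinearOrder V]

section

variable {K : Type*} [Field K] {G : SimpleGraph V}

theorem coboundaries_of_nonpos (W : Finset V) {k : ℤ} (hk : k ≤ 0) :
    Module.finrank K (coboundaries K G W k) = 0 := by
  have : coboundaries K G W k = ⊥ := by
    rw [eq_bot_iff]
    rintro _ ⟨f, hf, rfl⟩
    have : f = 0 := by
      funext A
      exact cochains_eq_zero_of_card hf (by omega)
    rw [this, map_zero]
    exact zero_mem _
  rw [this, finrank_bot]

theorem coboundaries_of_card_lt {W : Finset V} {k : ℤ} (hk : (W.card : ℤ) + 1 < k) :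
    Module.finrank K (coboundaries K G W k) = 0 := by
  have : coboundaries K G W k = ⊥ := by
    rw [eq_bot_iff]
    rintro _ ⟨f, hf, rfl⟩
    have : f = 0 := by
      funext A
      by_contra hA
      obtain ⟨h1, h2⟩ := hf A hA
      have := Finset.card_le_card h1.1
      omega
    rw [this, map_zero]
    exact zero_mem _
  rw [this, finrank_bot]

end

variable [Finite V] (K L : Type*) [Field K] [Field L] {G : SimpleGraph V}

variable (G) in
/-- The cohomology on `W` in dimension `k - 1` has the same dimension over `K` and over `L`. -/
def FieldIndep (W : Finset V) (k : ℤ) : Prop := cohDim K G W k = cohDim L G W k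

variable {K L}

theorem fieldIndep_of_acyclic {W : Finset V} {k : ℤ} (h : Acyclic K G W k)
    (h' : Acyclic L G W k) : FieldIndep K L G W k := by
  rw [FieldIndep, h.cohDim_eq_zero, h'.cohDim_eq_zero]

/-- One step of the Euler characteristic. -/
theorem cohDim_euler (W : Finset V) (k : ℤ) :
    cohDim K G W k + Module.finrank K (coboundaries K G W k) +
      Module.finrank K (coboundaries K G W (k + 1)) =
        Nat.card {A : Finset V // IsFace G W A ∧ (A.card : ℤ) = k} := by
  rw [cohDim_add_finrank, ← finrank_cochains_eq_card (K := K), finrank_cochains_eq, add_comm]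

/-- As the number of faces does not depend on the field, independence of the field passes between
the ranks of consecutive coboundary operators. -/
theorem FieldIndep.coboundaries_succ {W : Finset V} {k : ℤ} (h : FieldIndep K L G W k) :
    Module.finrank K (coboundaries K G W k) = Module.finrank L (coboundaries L G W k) ↔
      Module.finrank K (coboundaries K G W (k + 1)) =
        Module.finrank L (coboundaries L G W (k + 1)) := by
  have h1 := cohDim_euler (K := K) (G := G) W k
  have h2 := cohDim_euler (K := L) (G := G) W k
  rw [← h1, h] at h2
  omega

/-- If the cohomology in all dimensions but one is independent of the field, then so is the
remaining one, as the Euler characteristic is. -/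
theorem fieldIndep_of_forall_ne {W : Finset V} {k : ℤ} (h : ∀ j ≠ k, FieldIndep K L G W j) :
    FieldIndep K L G W k := by
  have low : ∀ n : ℕ, (n : ℤ) ≤ k → Module.finrank K (coboundaries K G W n) =
      Module.finrank L (coboundaries L G W n) := by
    intro n
    induction n with
    | zero =>
      intro _
      rw [coboundaries_of_nonpos W (by simp), coboundaries_of_nonpos W (by simp)]
    | succ n ih =>
      intro hn
      push_cast at hn ⊢
      exact (h n (by omega)).coboundaries_succ.mp (ih (by omega))
  have low' : Module.finrank K (coboundaries K G W k) =
      Module.finrank L (coboundaries L G W k) := by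
    rcases le_or_gt k 0 with hk | hk
    · rw [coboundaries_of_nonpos W hk, coboundaries_of_nonpos W hk]
    · lift k to ℕ using hk.le
      exact low k le_rfl
  have high : ∀ n : ℕ, ∀ j : ℤ, k < j → (W.card : ℤ) + 1 < j + n →
      Module.finrank K (coboundaries K G W j) = Module.finrank L (coboundaries L G W j) := by
    intro n
    induction n with
    | zero =>
      intro j _ hj
      rw [coboundaries_of_card_lt (by simpa using hj), coboundaries_of_card_lt (by simpa using hj)]
    | succ n ih =>
      intro j hkj hj
      push_cast at hj
      exact (h j hkj.ne').coboundaries_succ.mpr (ih (j + 1) (by omega) (by omega))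
  have high' := high ((W.card + 2 - k).toNat) (k + 1) (by omega) (by omega)
  have h1 := cohDim_euler (K := K) (G := G) W k
  have h2 := cohDim_euler (K := L) (G := G) W k
  rw [FieldIndep]
  omega

theorem fieldIndep_empty (k : ℤ) : FieldIndep K L G ∅ k := by
  rcases lt_trichotomy k 0 with hk | rfl | hk
  · exact fieldIndep_of_acyclic (acyclic_of_card_lt_zero _ hk) (acyclic_of_card_lt_zero _ hk)
  · refine fieldIndep_of_forall_ne fun j hj => ?_
    rcases lt_or_gt_of_ne hj with hj | hj
    · exact fieldIndep_of_acyclic (acyclic_of_card_lt_zero _ hj) (acyclic_of_card_lt_zero _ hj)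
    · exact fieldIndep_of_acyclic (acyclic_of_card_lt (by simpa using hj))
        (acyclic_of_card_lt (by simpa using hj))
  · exact fieldIndep_of_acyclic (acyclic_of_card_lt (by simpa using hk))
      (acyclic_of_card_lt (by simpa using hk))

theorem fieldIndep_zero (W : Finset V) : FieldIndep K L G W 0 := by
  rcases W.eq_empty_or_nonempty with rfl | hW
  · exact fieldIndep_empty 0
  · exact fieldIndep_of_acyclic (acyclic_zero hW) (acyclic_zero hW)

theorem fieldIndep_one (W : Finset V) : FieldIndep K L G W 1 := by
  have h := (fieldIndep_zero (K := K) (L := L) (G := G) W).coboundaries_succ.mp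
    (by rw [coboundaries_of_nonpos W le_rfl, coboundaries_of_nonpos W le_rfl])
  rw [zero_add] at h
  have h1 := cohDim_add_finrank (K := K) (G := G) W 1
  have h2 := cohDim_add_finrank (K := L) (G := G) W 1
  rw [finrank_cocycles_one] at h1 h2
  rw [FieldIndep]
  omega

theorem fieldIndep_of_le_one (W : Finset V) {k : ℤ} (hk : k ≤ 1) : FieldIndep K L G W k := by
  rcases lt_trichotomy k 0 with h | rfl | h
  · exact fieldIndep_of_acyclic (acyclic_of_card_lt_zero _ h) (acyclic_of_card_lt_zero _ h)
  · exact fieldIndep_zero W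
  · obtain rfl : k = 1 := by omega
    exact fieldIndep_one W

theorem fieldIndep_of_isolated {W : Finset V} {u : V} (hu : u ∈ W) (h : (nbrs G W u).card = 0)
    (k : ℤ) : FieldIndep K L G W k := by
  have h0 : ∀ w ∈ W, ¬G.Adj u w := by
    intro w hw hadj
    have := Finset.card_pos.mpr ⟨w, mem_nbrs.mpr ⟨hw, hadj⟩⟩
    omega
  exact fieldIndep_of_acyclic (acyclic_of_isolated hu h0 k) (acyclic_of_isolated hu h0 k)

/-- A vertex of degree one reduces the question to a smaller graph, one dimension lower. -/
theorem exists_fieldIndep_of_leaf {W : Finset V} {u : V} (hu : u ∈ W)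
    (h : (nbrs G W u).card = 1) (k : ℤ) :
    ∃ v ∈ W, (nbrs G W v).Nonempty ∧
      (FieldIndep K L G (nonNbrs G W v) (k - 1) → FieldIndep K L G W k) := by
  obtain ⟨v, hv⟩ := Finset.card_eq_one.mp h
  have hv' : v ∈ nbrs G W u := by simp [hv]
  have huv := mem_nbrs.mp hv'
  refine ⟨v, huv.1, ⟨u, mem_nbrs.mpr ⟨hu, huv.2.symm⟩⟩, fun hL => ?_⟩
  have h0 : ∀ w ∈ W, G.Adj u w → w = v := by
    intro w hw hadj
    have : w ∈ nbrs G W u := mem_nbrs.mpr ⟨hw, hadj⟩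
    simpa [hv] using this
  rw [FieldIndep, cohDim_of_leaf hu huv.1 huv.2 h0, cohDim_of_leaf hu huv.1 huv.2 h0, hL]

theorem fieldIndep_of_erase {W : Finset V} {v : V} (hv : v ∈ W) {k : ℤ}
    (h0 : Acyclic K G (nonNbrs G W v) k) (h1 : Acyclic K G (nonNbrs G W v) (k - 1))
    (h0' : Acyclic L G (nonNbrs G W v) k) (h1' : Acyclic L G (nonNbrs G W v) (k - 1))
    (h : FieldIndep K L G (W.erase v) k) : FieldIndep K L G W k := by
  rw [FieldIndep, cohDim_erase_of_acyclic hv h0 h1, cohDim_erase_of_acyclic hv h0' h1', h]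

theorem fieldIndep_of_card_le_two_mul {W : Finset V} {k : ℤ} (h : (W.card : ℤ) ≤ 2 * k) :
    FieldIndep K L G W k := by
  induction hn : W.card using Nat.strong_induction_on generalizing W k with
  | _ n ih =>
    subst hn
    rcases h.lt_or_eq with h | h
    · exact fieldIndep_of_acyclic (acyclic_of_card_lt h) (acyclic_of_card_lt h)
    rcases W.eq_empty_or_nonempty with rfl | ⟨u, hu⟩
    · exact fieldIndep_empty k
    by_cases hdeg : (nbrs G W u).card = 1
    · obtain ⟨v, hv, hne, hL⟩ := exists_fieldIndep_of_leaf (K := K) (L := L) hu hdeg k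
      have h1 := card_nonNbrs (G := G) hv
      have h2 := hne.card_pos
      exact hL (ih _ (by omega) (by omega) rfl)
    · exact fieldIndep_of_acyclic (acyclic_of_card_eq h hu hdeg) (acyclic_of_card_eq h hu hdeg)

/-- After the reductions at vertices of other degrees, the graph may be assumed to be 2-regular.
Then the vertices outside a closed neighbourhood form a perfect matching only for the pentagon,
which is settled by its Euler characteristic. -/
theorem fieldIndep_of_card_le_two_mul_add_one {W : Finset V} {k : ℤ}
    (h : (W.card : ℤ) ≤ 2 * k + 1) : FieldIndep K L G W k := by
  induction hn : W.card using Nat.strong_induction_on generalizing W k with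
  | _ n ih =>
    subst hn
    rcases le_or_gt k 1 with hk | hk
    · exact fieldIndep_of_le_one W hk
    rcases h.lt_or_eq with h | h
    · exact fieldIndep_of_card_le_two_mul (by omega)
    by_cases hiso : ∃ v ∈ W, (nbrs G W v).card = 0
    · obtain ⟨v, hv, hv0⟩ := hiso
      exact fieldIndep_of_isolated hv hv0 k
    by_cases hleaf : ∃ v ∈ W, (nbrs G W v).card = 1
    · obtain ⟨u, hu, hdeg⟩ := hleaf
      obtain ⟨v, hv, hne, hL⟩ := exists_fieldIndep_of_leaf (K := K) (L := L) hu hdeg k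
      have h1 := card_nonNbrs (G := G) hv
      have h2 := hne.card_pos
      exact hL (ih _ (by omega) (by omega) rfl)
    by_cases hbig : ∃ v ∈ W, 3 ≤ (nbrs G W v).card
    · obtain ⟨v, hv, hdeg⟩ := hbig
      have h1 := card_nonNbrs (G := G) hv
      have h3 := Finset.card_erase_add_one hv
      exact fieldIndep_of_erase hv (acyclic_of_card_lt (by omega)) (acyclic_of_card_lt (by omega))
        (acyclic_of_card_lt (by omega)) (acyclic_of_card_lt (by omega))
        (fieldIndep_of_card_le_two_mul (by omega))
    push Not at hiso hleaf hbig
    have hreg : ∀ v ∈ W, (nbrs G W v).card = 2 := by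
      intro v hv
      have := hiso v hv
      have := hleaf v hv
      have := hbig v hv
      omega
    obtain ⟨v, hv⟩ : W.Nonempty := Finset.card_pos.mp (by omega)
    have h1 := card_nonNbrs (G := G) hv
    have h3 := Finset.card_erase_add_one hv
    have hd := hreg v hv
    by_cases hmatch : ∃ w ∈ nonNbrs G W v, (nbrs G (nonNbrs G W v) w).card ≠ 1
    · obtain ⟨w, hw, hw1⟩ := hmatch
      exact fieldIndep_of_erase hv (acyclic_of_card_lt (by omega))
        (acyclic_of_card_eq (by omega) hw hw1) (acyclic_of_card_lt (by omega))
        (acyclic_of_card_eq (by omega) hw hw1) (fieldIndep_of_card_le_two_mul (by omega))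
    · push Not at hmatch
      have hcount := card_nonNbrs_mul_le (G := G) (W := W) (v := v) (m := 1) (n := 1)
        (fun w hw => by
          have e1 := card_nbrs_le_add hw
          have e2 := hreg w (nonNbrs_subset W v hw)
          have e3 := hmatch w hw
          omega)
        (fun w hw => by
          have e1 := card_nbrs_nonNbrs_lt hv hw
          have e2 := hreg w (nbrs_subset W v hw)
          omega)
      refine fieldIndep_of_forall_ne fun j hj => ?_
      rcases lt_or_gt_of_ne hj with hj | hj
      · exact fieldIndep_of_le_one W (by omega)
      · exact fieldIndep_of_acyclic (acyclic_of_card_lt (by omega)) (acyclic_of_card_lt (by omega))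

theorem fieldIndep_two {W : Finset V} (h : W.card ≤ 7) : FieldIndep K L G W 2 := by
  refine fieldIndep_of_forall_ne fun j hj => ?_
  rcases lt_or_gt_of_ne hj with hj | hj
  · exact fieldIndep_of_le_one W (by omega)
  · exact fieldIndep_of_card_le_two_mul_add_one (by omega)

end FieldIndependence

/-! ### Graphs on eight vertices -/

section EightVertices

variable {V : Type*} [LinearOrder V] {G : SimpleGraph V}

theorem Acyclic.of_leaf {K : Type*} [Field K] {W : Finset V} {u v : V} {k : ℤ} (hu : u ∈ W)
    (hv : v ∈ W) (huv : G.Adj u v) (h : ∀ w ∈ W, G.Adj u w → w = v)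
    (hL : Acyclic K G (nonNbrs G W v) (k - 1)) : Acyclic K G W k :=
  Acyclic.of_vertex hv (acyclic_erase_of_leaf hu huv h k) hL

/-- If `a` has at most one neighbour and every vertex at most two neighbours among four vertices,
then their independence complex is connected. -/
theorem acyclic_one_of_card_nbrs_le {K : Type*} [Field K] {U : Finset V} (hU : U.card = 4) {a : V}
    (ha : a ∈ U) (h1 : (nbrs G U a).card ≤ 1) (h2 : ∀ z ∈ U, (nbrs G U z).card ≤ 2) :
    Acyclic K G U 1 := by
  refine acyclic_one_of_connected (a := a) fun f hf r hr => ?_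
  by_cases hadj : G.Adj r a
  · have e1 := card_nonNbrs (G := G) hr
    have e2 := h2 r hr
    obtain ⟨t, ht⟩ : (nonNbrs G U r).Nonempty := Finset.card_pos.mp (by omega)
    obtain ⟨htU, htr, hrt⟩ := mem_nonNbrs.mp ht
    rw [hf r hr t htU hrt]
    refine hf t htU a ha fun hta => htr ?_
    exact Finset.card_le_one.mp h1 t (mem_nbrs.mpr ⟨htU, hta.symm⟩) r
      (mem_nbrs.mpr ⟨hr, hadj.symm⟩)
  · exact hf r hr a ha hadj

/-- The configuration left by the reductions at single vertices: all degrees are two or three, the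
vertices outside the closed neighbourhood of a vertex of degree three form a perfect matching, and
`p - x - q` is an induced path whose inner vertex `x` and whose end `p` have degree two. Removing
`p` leaves a suspension, over the vertices not adjacent to `q`, of a connected complex. -/
theorem acyclic_two_erase_of_path {K : Type*} [Field K] {W : Finset V} (hcard : W.card = 8)
    (hdeg : ∀ v ∈ W, (nbrs G W v).card = 2 ∨ (nbrs G W v).card = 3)
    (hmatch : ∀ v ∈ W, (nbrs G W v).card = 3 →
      ∀ w ∈ nonNbrs G W v, (nbrs G (nonNbrs G W v) w).card = 1)
    {x p q : V} (hx : x ∈ W) (hp : p ∈ W) (hq : q ∈ W) (hxp : G.Adj x p) (hxq : G.Adj x q)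
    (hpq : ¬G.Adj p q) (hne : p ≠ q) (hNx : ∀ w ∈ W, G.Adj x w → w = p ∨ w = q)
    (hcommon : ∀ w ∈ W, G.Adj p w → G.Adj q w → w = x) (hp2 : (nbrs G W p).card = 2) :
    Acyclic K G (W.erase p) 2 := by
  have hqp : q ∈ W.erase p := Finset.mem_erase.mpr ⟨hne.symm, hq⟩
  refine Acyclic.of_leaf (Finset.mem_erase.mpr ⟨hxp.ne, hx⟩) hqp hxq
    (fun w hw hxw => ?_) ?_
  · obtain ⟨hw1, hw2⟩ := Finset.mem_erase.mp hw
    exact (hNx w hw2 hxw).resolve_left hw1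
  change Acyclic K G _ 1
  have hUmem : ∀ z, z ∈ nonNbrs G (W.erase p) q ↔ z ∈ W ∧ z ≠ p ∧ z ≠ q ∧ ¬G.Adj q z := by
    intro z
    rw [mem_nonNbrs, Finset.mem_erase]
    tauto
  set U := nonNbrs G (W.erase p) q with hUdef
  have hUW : U ⊆ W := fun z hz => ((hUmem z).mp hz).1
  obtain ⟨a, ha⟩ := Finset.card_eq_one.mp (show ((nbrs G W p).erase x).card = 1 by
    rw [Finset.card_erase_of_mem (mem_nbrs.mpr ⟨hx, hxp.symm⟩), hp2])
  have ha' : a ∈ (nbrs G W p).erase x := by simp [ha]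
  obtain ⟨hax, ha'⟩ := Finset.mem_erase.mp ha'
  obtain ⟨haW, hpa⟩ := mem_nbrs.mp ha'
  have hqa : ¬G.Adj q a := fun h => hax (hcommon a haW hpa h)
  have haq : a ≠ q := by
    rintro rfl
    exact hpq hpa
  have haU : a ∈ U := (hUmem a).mpr ⟨haW, hpa.ne', haq, hqa⟩
  rcases hdeg q hq with hq2 | hq3
  · obtain ⟨b, hb⟩ := Finset.card_eq_one.mp (show ((nbrs G W q).erase x).card = 1 by
      rw [Finset.card_erase_of_mem (mem_nbrs.mpr ⟨hx, hxq.symm⟩), hq2])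
    have hb' : b ∈ (nbrs G W q).erase x := by simp [hb]
    obtain ⟨hbx, hb'⟩ := Finset.mem_erase.mp hb'
    obtain ⟨hbW, hqb⟩ := mem_nbrs.mp hb'
    have hbU : b ∉ U := fun h => ((hUmem b).mp h).2.2.2 hqb
    have hbp : b ≠ p := by
      rintro rfl
      exact hpq hqb.symm
    have hxz : ∀ z ∈ U, ¬G.Adj z x := by
      intro z hz h
      obtain ⟨h1, h2, h3, -⟩ := (hUmem z).mp hz
      exact (hNx z h1 h.symm).elim h2 h3
    -- Otherwise `q` would have the two neighbours `x` and `b` outside the closed neighbourhood.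
    have hzb : ∀ z ∈ U, (nbrs G W z).card = 3 → G.Adj z b := by
      intro z hz hz3
      by_contra hzb
      obtain ⟨hzW, -, hzq, hqz⟩ := (hUmem z).mp hz
      have hqL : q ∈ nonNbrs G W z := mem_nonNbrs.mpr ⟨hq, hzq.symm, fun h => hqz h.symm⟩
      have hxL : x ∈ nonNbrs G W z := by
        refine mem_nonNbrs.mpr ⟨hx, ?_, hxz z hz⟩
        rintro rfl
        exact hqz hxq.symm
      have hbL : b ∈ nonNbrs G W z := by
        refine mem_nonNbrs.mpr ⟨hbW, ?_, hzb⟩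
        rintro rfl
        exact hqz hqb
      exact hbx (Finset.card_le_one.mp (hmatch z hzW hz3 q hqL).le b (mem_nbrs.mpr ⟨hbL, hqb⟩) x
        (mem_nbrs.mpr ⟨hxL, hxq.symm⟩))
    have hsub : ∀ z, nbrs G U z ⊆ nbrs G W z := fun z w hw =>
      mem_nbrs.mpr ⟨hUW (mem_nbrs.mp hw).1, (mem_nbrs.mp hw).2⟩
    have hbnot : ∀ z, b ∉ nbrs G U z := fun z h => hbU (mem_nbrs.mp h).1
    have hpnot : p ∉ nbrs G U a := fun h => ((hUmem p).mp (mem_nbrs.mp h).1).2.1 rfl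
    have hpa' : p ∈ nbrs G W a := mem_nbrs.mpr ⟨hp, hpa.symm⟩
    refine acyclic_one_of_card_nbrs_le ?_ haU ?_ ?_
    · have e1 := card_nonNbrs (G := G) hqp
      have e2 : nbrs G (W.erase p) q = nbrs G W q := by
        ext w
        rw [mem_nbrs, mem_nbrs, Finset.mem_erase]
        constructor
        · exact fun h => ⟨h.1.2, h.2⟩
        · refine fun h => ⟨⟨?_, h.1⟩, h.2⟩
          rintro rfl
          exact hpq h.2.symm
      have e3 := Finset.card_erase_add_one hp
      rw [e2, ← hUdef] at e1
      omega
    · rcases hdeg a haW with h2 | h3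
      · have := Finset.card_le_card (Finset.subset_erase.mpr ⟨hsub a, hpnot⟩)
        rw [Finset.card_erase_of_mem hpa'] at this
        omega
      · have := Finset.card_le_card (Finset.subset_erase.mpr
          ⟨Finset.subset_erase.mpr ⟨hsub a, hpnot⟩, hbnot a⟩)
        rw [Finset.card_erase_of_mem (Finset.mem_erase.mpr
          ⟨hbp, mem_nbrs.mpr ⟨hbW, hzb a haU h3⟩⟩), Finset.card_erase_of_mem hpa'] at this
        omega
    · intro z hz
      rcases hdeg z (hUW hz) with h2 | h3
      · exact h2 ▸ Finset.card_le_card (hsub z)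
      · have := Finset.card_le_card (Finset.subset_erase.mpr ⟨hsub z, hbnot z⟩)
        rw [Finset.card_erase_of_mem (mem_nbrs.mpr ⟨hbW, hzb z hz h3⟩)] at this
        omega
  · -- The only neighbour of `a` outside the closed neighbourhood of `q` is `p`.
    refine acyclic_of_isolated haU (fun w hw haw => ?_) 1
    obtain ⟨hwW, hwp, hwq, hqw⟩ := (hUmem w).mp hw
    have haL : a ∈ nonNbrs G W q := mem_nonNbrs.mpr ⟨haW, haq, hqa⟩
    exact hwp (Finset.card_le_one.mp (hmatch q hq hq3 a haL).le w
      (mem_nbrs.mpr ⟨mem_nonNbrs.mpr ⟨hwW, hwq, hqw⟩, haw⟩) p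
      (mem_nbrs.mpr ⟨mem_nonNbrs.mpr ⟨hp, hne, fun h => hpq h.symm⟩, hpa.symm⟩))

variable [Finite V] {K L : Type*} [Field K] [Field L]

/-- On eight vertices the cohomology in dimensions one and two is not determined by the Euler
characteristic and the other dimensions; dimension two is treated by the long exact sequences of
vertices. Vertices of degree zero, one or at least four are removed first, then vertices that
dominate another vertex, then vertices of degree three whose link is acyclic in dimension one. In
the remaining graphs, removing a suitable neighbour of a vertex `x` of degree two leaves a complex
without cohomology in dimension one, so that the long exact sequence splits. -/
theorem fieldIndep_three {W : Finset V} (hcard : W.card = 8) : FieldIndep K L G W 3 := by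
  have h7 : ∀ v ∈ W, FieldIndep K L G (W.erase v) 3 := fun v hv =>
    fieldIndep_of_card_le_two_mul_add_one (by
      have := Finset.card_erase_add_one hv
      omega)
  have hL2 : ∀ v ∈ W, FieldIndep K L G (nonNbrs G W v) 2 := fun v hv =>
    fieldIndep_two (by
      have := card_nonNbrs (G := G) hv
      omega)
  by_cases hiso : ∃ v ∈ W, (nbrs G W v).card = 0
  · obtain ⟨v, hv, hv0⟩ := hiso
    exact fieldIndep_of_isolated hv hv0 3
  by_cases hleaf : ∃ v ∈ W, (nbrs G W v).card = 1
  · obtain ⟨u, hu, hdeg⟩ := hleaf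
    obtain ⟨v, hv, -, hL⟩ := exists_fieldIndep_of_leaf (K := K) (L := L) hu hdeg 3
    exact hL (hL2 v hv)
  by_cases hbig : ∃ v ∈ W, 4 ≤ (nbrs G W v).card
  · obtain ⟨v, hv, hdeg⟩ := hbig
    have h1 := card_nonNbrs (G := G) hv
    exact fieldIndep_of_erase hv (acyclic_of_card_lt (by omega)) (acyclic_of_card_lt (by omega))
      (acyclic_of_card_lt (by omega)) (acyclic_of_card_lt (by omega)) (h7 v hv)
  by_cases hfold : ∃ u ∈ W, ∃ v ∈ W, u ≠ v ∧ ¬G.Adj u v ∧ ∀ w ∈ W, G.Adj u w → G.Adj v w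
  · obtain ⟨u, hu, v, hv, hne, huv, h⟩ := hfold
    rw [FieldIndep, cohDim_erase_of_nbrs_subset hu hv hne huv h,
      cohDim_erase_of_nbrs_subset hu hv hne huv h, h7 v hv]
  by_cases hdom : ∃ u ∈ W, ∃ v ∈ W, G.Adj u v ∧ ∀ w ∈ W, G.Adj u w → w = v ∨ G.Adj v w
  · obtain ⟨u, hu, v, hv, huv, h⟩ := hdom
    rw [FieldIndep, cohDim_of_closed_nbrs_subset hu hv huv h,
      cohDim_of_closed_nbrs_subset hu hv huv h, h7 v hv]
    exact congrArg _ (hL2 v hv)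
  by_cases hmatch : ∃ v ∈ W, (nbrs G W v).card = 3 ∧
      ∃ w ∈ nonNbrs G W v, (nbrs G (nonNbrs G W v) w).card ≠ 1
  · obtain ⟨v, hv, hdeg, w, hw, hw1⟩ := hmatch
    have h1 := card_nonNbrs (G := G) hv
    exact fieldIndep_of_erase hv (acyclic_of_card_lt (by omega))
      (acyclic_of_card_eq (by omega) hw hw1) (acyclic_of_card_lt (by omega))
      (acyclic_of_card_eq (by omega) hw hw1) (h7 v hv)
  push Not at hiso hleaf hbig hfold hdom hmatch
  have hdeg : ∀ v ∈ W, (nbrs G W v).card = 2 ∨ (nbrs G W v).card = 3 := by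
    intro v hv
    have := hiso v hv
    have := hleaf v hv
    have := hbig v hv
    omega
  -- In a cubic graph, eight edges would join the four vertices outside the closed neighbourhood
  -- of a vertex to its three neighbours, which have room for six.
  obtain ⟨x, hx, hx2⟩ : ∃ x ∈ W, (nbrs G W x).card = 2 := by
    by_contra hcubic
    push Not at hcubic
    obtain ⟨v, hv⟩ : W.Nonempty := Finset.card_pos.mp (by omega)
    have h3 : ∀ w ∈ W, (nbrs G W w).card = 3 := fun w hw => (hdeg w hw).resolve_left (hcubic w hw)
    have hcount := card_nonNbrs_mul_le (G := G) (W := W) (v := v) (m := 2) (n := 2)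
      (fun w hw => by
        have e1 := card_nbrs_le_add hw
        have e2 := h3 w (nonNbrs_subset W v hw)
        have e3 := hmatch v hv (h3 v hv) w hw
        omega)
      (fun w hw => by
        have e1 := card_nbrs_nonNbrs_lt hv hw
        have e2 := h3 w (nbrs_subset W v hw)
        omega)
    have e1 := card_nonNbrs (G := G) hv
    have e2 := h3 v hv
    omega
  obtain ⟨p, q, hne, hpq⟩ := Finset.card_eq_two.mp hx2
  obtain ⟨hp, hxp⟩ := mem_nbrs.mp (show p ∈ nbrs G W x by simp [hpq])
  obtain ⟨hq, hxq⟩ := mem_nbrs.mp (show q ∈ nbrs G W x by simp [hpq])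
  have hNx : ∀ w ∈ W, G.Adj x w → w = p ∨ w = q := by
    intro w hw hxw
    have : w ∈ nbrs G W x := mem_nbrs.mpr ⟨hw, hxw⟩
    simpa [hpq] using this
  have hnadj : ¬G.Adj p q := by
    intro hadj
    obtain ⟨w, hw, hxw, hwp, hpw⟩ := hdom x hx p hp hxp
    rcases hNx w hw hxw with rfl | rfl
    · exact hwp rfl
    · exact hpw hadj
  have hcommon : ∀ w ∈ W, G.Adj p w → G.Adj q w → w = x := by
    intro w hw hpw hqw
    by_contra hwx
    have hxw : ¬G.Adj x w := by
      intro hxw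
      rcases hNx w hw hxw with rfl | rfl
      · exact G.loopless.irrefl _ hpw
      · exact G.loopless.irrefl _ hqw
    obtain ⟨z, hz, hxz, hwz⟩ := hfold x hx w hw (Ne.symm hwx) hxw
    rcases hNx z hz hxz with rfl | rfl
    · exact hwz hpw.symm
    · exact hwz hqw.symm
  have finish : ∀ v ∈ W, Acyclic K G (W.erase v) 2 → Acyclic L G (W.erase v) 2 →
      FieldIndep K L G W 3 := by
    intro v hv hK hL
    have e1 := card_nonNbrs (G := G) hv
    have e2 := hdeg v hv
    have key : ∀ j : ℤ, j = 3 → Acyclic K G (nonNbrs G W v) j ∧ Acyclic L G (nonNbrs G W v) j :=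
      fun j hj => ⟨acyclic_of_card_lt (by omega), acyclic_of_card_lt (by omega)⟩
    rw [FieldIndep, cohDim_vertex hv subset_rfl (nonNbrs_subset_erase W v) (key 3 rfl).1
      (nonNbrs_subset_erase W v) subset_rfl hK, cohDim_vertex hv subset_rfl
      (nonNbrs_subset_erase W v) (key 3 rfl).2 (nonNbrs_subset_erase W v) subset_rfl hL, h7 v hv]
    exact congrArg _ (hL2 v hv)
  rcases hdeg p hp with hp2 | hp3
  · exact finish p hp
      (acyclic_two_erase_of_path hcard hdeg hmatch hx hp hq hxp hxq hnadj hne hNx hcommon hp2)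
      (acyclic_two_erase_of_path hcard hdeg hmatch hx hp hq hxp hxq hnadj hne hNx hcommon hp2)
  · rcases hdeg q hq with hq2 | hq3
    · have hnadj' : ¬G.Adj q p := fun h => hnadj h.symm
      have hNx' : ∀ w ∈ W, G.Adj x w → w = q ∨ w = p := fun w hw h => (hNx w hw h).symm
      have hcommon' : ∀ w ∈ W, G.Adj q w → G.Adj p w → w = x := fun w hw h h' =>
        hcommon w hw h' h
      exact finish q hq
        (acyclic_two_erase_of_path hcard hdeg hmatch hx hq hp hxq hxp hnadj' hne.symm hNx'
          hcommon' hq2)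
        (acyclic_two_erase_of_path hcard hdeg hmatch hx hq hp hxq hxp hnadj' hne.symm hNx'
          hcommon' hq2)
    · -- Two neighbours of `p` other than `x` would lie outside the closed neighbourhood of `q`.
      exfalso
      have hpL : p ∈ nonNbrs G W q := mem_nonNbrs.mpr ⟨hp, hne, fun h => hnadj h.symm⟩
      have e1 := card_nbrs_le_add hpL
      have e2 := hmatch q hq hq3 p hpL
      have e3 : (nbrs G (nbrs G W q) p).card ≤ 1 := by
        refine Finset.card_le_one.mpr fun y hy z hz => ?_
        have : ∀ y ∈ nbrs G (nbrs G W q) p, y = x := fun y hy =>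
          hcommon y (mem_nbrs.mp (mem_nbrs.mp hy).1).1 (mem_nbrs.mp hy).2
            (mem_nbrs.mp (mem_nbrs.mp hy).1).2
        rw [this y hy, this z hz]
      omega

/-- The vertices `W` and the dimension `k - 1` contribute to the Betti number of index
`W.card - k`. -/
theorem fieldIndep_of_card_sub_le_five {W : Finset V} {k : ℤ} (h : (W.card : ℤ) - k ≤ 5) :
    FieldIndep K L G W k := by
  rcases le_or_gt (W.card : ℤ) (2 * k + 1) with h1 | h1
  · exact fieldIndep_of_card_le_two_mul_add_one h1
  rcases le_or_gt k 1 with h2 | h2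
  · exact fieldIndep_of_le_one W h2
  obtain rfl | rfl : k = 2 ∨ k = 3 := by omega
  · exact fieldIndep_two (by omega)
  · exact fieldIndep_three (by omega)

end EightVertices

/-! ### The Koszul complex -/

section Koszul

section

variable (K V M : Type*) [Field K] [AddCommGroup M] [Module K M]

/-- The Koszul chains supported on sets with `k` elements. -/
def koszulChains (k : ℤ) : Submodule K (Finset V → M) where
  carrier := {f | ∀ T, f T ≠ 0 → (T.card : ℤ) = k}
  add_mem' {f g} hf hg T h := by
    by_cases h1 : f T = 0
    · exact hg T fun h2 => h (by simp [h1, h2])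
    · exact hf T h1
  zero_mem' T h := absurd rfl h
  smul_mem' c f hf T h := hf T fun h2 => h (by simp [h2])

variable {K V M}

theorem koszulChains_eq_zero {k : ℤ} {f : Finset V → M} (hf : f ∈ koszulChains K V M k)
    {T : Finset V} (h : (T.card : ℤ) ≠ k) : f T = 0 := by
  by_contra h0
  exact h (hf T h0)

theorem map_mem_koszulChains {N : Type*} [AddCommGroup N] [Module K N] {π : M → N}
    (hπ : π 0 = 0) {k : ℤ} {f : Finset V → M} (hf : f ∈ koszulChains K V M k) :
    (fun T => π (f T)) ∈ koszulChains K V N k :=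
  fun T hT => hf T fun h0 => hT (by simp only [h0, hπ])

/-- Koszul chains lift along surjections. -/
theorem exists_koszulChains_lift {N : Type*} [AddCommGroup N] [Module K N] {π : M → N}
    (h0 : π 0 = 0) (hπ : Function.Surjective π) {k : ℤ} {g : Finset V → N}
    (hg : g ∈ koszulChains K V N k) : ∃ f ∈ koszulChains K V M k, ∀ T, π (f T) = g T := by
  classical
  choose s hs using hπ
  refine ⟨fun T => if g T = 0 then 0 else s (g T), fun T hT => hg T fun hT0 => hT (if_pos hT0),
    fun T => ?_⟩
  by_cases hT : g T = 0
  · simp only [hT, if_true, h0]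
  · simp only [if_neg hT, hs]

end

variable (K V : Type*) [LinearOrder V] [Field K] (M : Type*) [AddCommGroup M]
  [Module (MvPolynomial V K) M] [Module K M] [IsScalarTower K (MvPolynomial V K) M]

/-- The differential of the Koszul complex of the variables with coefficients in `M`. The basis
element of the Koszul complex indexed by a set of variables is represented by the complement of
that set, so that sets with `k` elements correspond to homological degree `|V| - k`, and the
differential raises `k` by one. -/
noncomputable def koszul : (Finset V → M) →ₗ[K] (Finset V → M) :=
  dif fun v => (LinearMap.lsmul (MvPolynomial V K) M (X v)).restrictScalars K

/-- The Koszul cycles supported on sets with `k` elements. -/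
noncomputable def koszulCycles (k : ℤ) : Submodule K (Finset V → M) :=
  koszulChains K V M k ⊓ LinearMap.ker (koszul K V M)

/-- The Koszul boundaries supported on sets with `k` elements. -/
noncomputable def koszulBoundaries (k : ℤ) : Submodule K (Finset V → M) :=
  (koszulChains K V M (k - 1)).map (koszul K V M)

/-- The dimension of the Koszul homology of `M` in homological degree `|V| - k`. -/
noncomputable def koszulDim (k : ℤ) : ℕ :=
  quotDim (koszulCycles K V M k) (koszulBoundaries K V M k)

variable {K V M}

theorem koszul_apply (f : Finset V → M) (T : Finset V) :
    koszul K V M f T =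
      ∑ u ∈ T, insertSign u (T.erase u) • (X u : MvPolynomial V K) • f (T.erase u) := rfl

theorem koszul_koszul (f : Finset V → M) : koszul K V M (koszul K V M f) = 0 :=
  dif_dif (fun u v x => smul_comm (X u : MvPolynomial V K) (X v : MvPolynomial V K) x) f

theorem koszul_naturality {N : Type*} [AddCommGroup N] [Module (MvPolynomial V K) N] [Module K N]
    [IsScalarTower K (MvPolynomial V K) N] (π : M →ₗ[MvPolynomial V K] N) (f : Finset V → M)
    (T : Finset V) : koszul K V N (fun T => π (f T)) T = π (koszul K V M f T) :=
  dif_naturality (π.restrictScalars K) (fun v x => π.map_smul (X v) x) f T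

theorem koszul_mem_koszulChains {k : ℤ} {f : Finset V → M} (hf : f ∈ koszulChains K V M k) :
    koszul K V M f ∈ koszulChains K V M (k + 1) := by
  intro T hT
  rw [koszul_apply] at hT
  obtain ⟨u, hu, hne⟩ := Finset.exists_ne_zero_of_sum_ne_zero hT
  have h1 : f (T.erase u) ≠ 0 := fun h0 => hne (by rw [h0, smul_zero, smul_zero])
  have := hf _ h1
  rw [Finset.card_erase_of_mem hu] at this
  have := Finset.card_pos.mpr ⟨u, hu⟩
  omega

theorem koszul_apply_mem {I : Submodule (MvPolynomial V K) M} {f : Finset V → M}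
    (hf : ∀ T, f T ∈ I) (T : Finset V) : koszul K V M f T ∈ I := by
  rw [koszul_apply]
  refine sum_mem fun u _ => ?_
  rw [Units.smul_def]
  exact zsmul_mem (I.smul_mem _ (hf _)) _

end Koszul

/-! ### Multidegrees in the Koszul complex of a Stanley–Reisner ring -/

section Multidegree

variable {K V : Type*} [Field K]

theorem coeff_units_smul (s : ℤˣ) (p : MvPolynomial V K) (μ : V →₀ ℕ) :
    coeff μ (s • p) = s • coeff μ p := by
  rcases Int.units_eq_one_or s with rfl | rfl <;> simp

theorem mem_edgeIdeal_iff {G : SimpleGraph V} {f : MvPolynomial V K} :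
    f ∈ edgeIdeal K G ↔ ∀ μ ∈ f.support, ¬G.IsIndepSet (μ.support : Set V) := by
  have h1 : edgeIdeal K G = Ideal.span ((fun s => monomial s (1 : K)) ''
      {s | ∃ u v, G.Adj u v ∧ s = Finsupp.single u 1 + Finsupp.single v 1}) := by
    unfold edgeIdeal
    congr 1
    ext f
    constructor
    · rintro ⟨u, v, h, rfl⟩
      exact ⟨_, ⟨u, v, h, rfl⟩, by simp [X, monomial_mul]⟩
    · rintro ⟨_, ⟨u, v, h, rfl⟩, rfl⟩
      exact ⟨u, v, h, by simp [X, monomial_mul]⟩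
  rw [h1, mem_ideal_span_monomial_image]
  refine forall₂_congr fun μ _ => ?_
  constructor
  · rintro ⟨_, ⟨u, v, h, rfl⟩, hle⟩ hind
    have hu := hle u
    have hv := hle v
    simp only [Finsupp.add_apply, Finsupp.single_eq_same] at hu hv
    exact hind (by simp; omega) (by simp; omega) h.ne h
  · intro h
    classical
    rw [SimpleGraph.isIndepSet_iff, Set.Pairwise] at h
    push Not at h
    obtain ⟨u, hu, v, hv, hne, hadj⟩ := h
    refine ⟨_, ⟨u, v, hadj, rfl⟩, fun w => ?_⟩
    simp only [Finset.mem_coe, Finsupp.mem_support_iff] at hu hv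
    simp only [Finsupp.add_apply, Finsupp.single_apply]
    split_ifs with h1 h2 h2
    · exact absurd (h1.trans h2.symm) hne
    · subst h1; omega
    · subst h2; omega
    · omega

/-- The exponent of the square-free monomial with support `B`. -/
noncomputable def sqfreeExp (B : Finset V) : V →₀ ℕ := Finsupp.indicator B fun _ _ => 1

open Classical in
theorem sqfreeExp_apply (B : Finset V) (v : V) : sqfreeExp B v = if v ∈ B then 1 else 0 := by
  simp [sqfreeExp, Finsupp.indicator_apply]

theorem support_sqfreeExp (B : Finset V) : (sqfreeExp B).support = B := by
  ext v
  simp [sqfreeExp_apply]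

theorem sqfreeExp_injective : Function.Injective (sqfreeExp : Finset V → V →₀ ℕ) := fun A B h => by
  rw [← support_sqfreeExp A, h, support_sqfreeExp]

theorem eq_sqfreeExp {μ : V →₀ ℕ} (h : ∀ v, μ v ≤ 1) : μ = sqfreeExp μ.support := by
  ext v
  rw [sqfreeExp_apply]
  have := h v
  split_ifs with hv
  · have := Finsupp.mem_support_iff.mp hv
    omega
  · exact Finsupp.notMem_support_iff.mp hv

variable [LinearOrder V]

theorem sqfreeExp_erase_add {B : Finset V} {v : V} (h : v ∈ B) :
    sqfreeExp B = sqfreeExp (B.erase v) + Finsupp.single v 1 := by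
  ext w
  simp only [Finsupp.add_apply, sqfreeExp_apply, Finsupp.single_apply, Finset.mem_erase]
  by_cases hw : v = w
  · subst hw
    simp [h]
  · simp [hw, Ne.symm hw]

variable [Fintype V]

/-- The sign relating the Koszul differential to the coboundary in multidegree `W`. -/
def twistSign (W B : Finset V) : ℤˣ := ∏ b ∈ B, insertSign b Wᶜ

variable (K) in
open Classical in
/-- The component in the square-free multidegree `W` of a Koszul chain with polynomial
coefficients, as a function on faces: at a face `B` it is the coefficient of the monomial on `B`,
which together with the exterior product over `W \ B` has multidegree `W`. -/
noncomputable def toCochain (G : SimpleGraph V) (W : Finset V) :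
    (Finset V → MvPolynomial V K) →ₗ[K] (Finset V → K) where
  toFun f B := if IsFace G W B then twistSign W B • coeff (sqfreeExp B) (f (B ∪ Wᶜ)) else 0
  map_add' f g := by
    funext B
    by_cases h : IsFace G W B <;> simp [h]
  map_smul' c f := by
    funext B
    by_cases h : IsFace G W B
    · simp only [if_pos h, Pi.smul_apply, RingHom.id_apply, coeff_smul]
      exact smul_comm _ _ _
    · simp [h]

variable {G : SimpleGraph V}

theorem toCochain_of_isFace {W B : Finset V} (h : IsFace G W B)
    (f : Finset V → MvPolynomial V K) :
    toCochain K G W f B = twistSign W B • coeff (sqfreeExp B) (f (B ∪ Wᶜ)) := if_pos h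

theorem toCochain_of_not_isFace {W B : Finset V} (h : ¬IsFace G W B)
    (f : Finset V → MvPolynomial V K) : toCochain K G W f B = 0 := if_neg h

theorem toCochain_mem_cochains {W : Finset V} {k : ℤ} {f : Finset V → MvPolynomial V K}
    (hf : f ∈ koszulChains K V (MvPolynomial V K) k) :
    toCochain K G W f ∈ cochains K G W (k - Fintype.card V + W.card) := by
  intro B hB
  by_cases h : IsFace G W B
  · refine ⟨h, ?_⟩
    rw [toCochain_of_isFace h] at hB
    have h1 : f (B ∪ Wᶜ) ≠ 0 := fun h0 => hB (by rw [h0, coeff_zero, smul_zero])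
    have h2 := hf _ h1
    rw [Finset.card_union_of_disjoint (disjoint_compl_right.mono_left h.1),
      Finset.card_compl] at h2
    have := Finset.card_le_univ W
    omega
  · exact absurd (toCochain_of_not_isFace h f) hB

theorem cobd_toCochain (W : Finset V) (f : Finset V → MvPolynomial V K) :
    cobd K G W (toCochain K G W f) = toCochain K G W (koszul K V (MvPolynomial V K) f) := by
  funext B
  by_cases h : IsFace G W B
  · have hdisj : Disjoint B Wᶜ := disjoint_compl_right.mono_left h.1
    rw [cobd_of_isFace h, toCochain_of_isFace h, koszul_apply, coeff_sum,
      Finset.sum_union hdisj, Finset.sum_eq_zero (s := Wᶜ), add_zero, Finset.smul_sum]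
    · refine Finset.sum_congr rfl fun u hu => ?_
      have huW : u ∉ Wᶜ := fun h1 => Finset.disjoint_left.mp hdisj hu h1
      have h1 : (B ∪ Wᶜ).erase u = B.erase u ∪ Wᶜ := by
        rw [Finset.erase_union_distrib, Finset.erase_eq_of_notMem huW]
      have h2 : twistSign W B = insertSign u Wᶜ * twistSign W (B.erase u) :=
        (Finset.mul_prod_erase B _ hu).symm
      rw [toCochain_of_isFace (h.mono (Finset.erase_subset _ _)), h1, h2,
        insertSign_union (hdisj.mono_left (Finset.erase_subset _ _)), coeff_units_smul, smul_eq_mul,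
        mul_comm (X u), sqfreeExp_erase_add hu, coeff_mul_X, smul_smul, smul_smul]
      congr 1
      rw [mul_comm (insertSign u Wᶜ) (twistSign W _), mul_assoc,
        mul_left_comm (insertSign u Wᶜ), Int.units_mul_self, mul_one, mul_comm]
    · intro u hu
      have huB : u ∉ B := fun h1 => Finset.disjoint_left.mp hdisj h1 hu
      rw [coeff_units_smul, smul_eq_mul, coeff_X_mul', if_neg, smul_zero]
      rwa [support_sqfreeExp]
  · rw [cobd_of_not_isFace h, toCochain_of_not_isFace h]

variable {I : Ideal (MvPolynomial V K)}
  (hI : ∀ f, f ∈ I ↔ ∀ μ ∈ f.support, ¬G.IsIndepSet (μ.support : Set V))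

include hI in
theorem toCochain_eq_zero {f : Finset V → MvPolynomial V K} (hf : ∀ T, f T ∈ I) (W : Finset V) :
    toCochain K G W f = 0 := by
  funext B
  by_cases h : IsFace G W B
  · rw [toCochain_of_isFace h, Pi.zero_apply]
    by_contra h0
    have h1 : sqfreeExp B ∈ (f (B ∪ Wᶜ)).support :=
      mem_support_iff.mpr fun h2 => h0 (by rw [h2, smul_zero])
    refine (hI _).mp (hf _) _ h1 ?_
    rw [support_sqfreeExp]
    exact h.2
  · exact toCochain_of_not_isFace h f

/-- The Koszul chain in multidegree `W` with given components. -/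
noncomputable def ofCochain (W : Finset V) (c : Finset V → K) : Finset V → MvPolynomial V K :=
  fun T => if Wᶜ ⊆ T then monomial (sqfreeExp (T ∩ W)) (twistSign W (T ∩ W) • c (T ∩ W)) else 0

theorem ofCochain_mem_koszulChains {W : Finset V} {k : ℤ} {c : Finset V → K}
    (hc : c ∈ cochains K G W (k - Fintype.card V + W.card)) :
    ofCochain W c ∈ koszulChains K V (MvPolynomial V K) k := by
  intro T hT
  unfold ofCochain at hT
  split_ifs at hT with h
  · have h1 : c (T ∩ W) ≠ 0 := fun h0 => hT (by rw [h0, smul_zero, map_zero])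
    have h2 := (hc _ h1).2
    have h3 := Finset.card_inter_add_card_sdiff T W
    have h4 : T \ W = Wᶜ := by
      ext v
      simp only [Finset.mem_sdiff, Finset.mem_compl]
      exact ⟨fun h => h.2, fun hv => ⟨h (by simpa using hv), hv⟩⟩
    rw [h4, Finset.card_compl] at h3
    have := Finset.card_le_univ W
    omega
  · exact absurd rfl hT

theorem toCochain_ofCochain_self {W : Finset V} {k : ℤ} {c : Finset V → K}
    (hc : c ∈ cochains K G W k) : toCochain K G W (ofCochain W c) = c := by
  funext B
  by_cases h : IsFace G W B
  · have h1 : (B ∪ Wᶜ) ∩ W = B := by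
      ext v
      have := @h.1 v
      simp only [Finset.mem_inter, Finset.mem_union, Finset.mem_compl]
      tauto
    rw [toCochain_of_isFace h, ofCochain, if_pos Finset.subset_union_right, h1, coeff_monomial,
      if_pos rfl, smul_smul, Int.units_mul_self, one_smul]
  · rw [toCochain_of_not_isFace h, cochains_eq_zero_of_not_isFace hc h]

theorem toCochain_ofCochain_of_ne {W W' : Finset V} (hne : W' ≠ W) (c : Finset V → K) :
    toCochain K G W' (ofCochain W c) = 0 := by
  funext B
  by_cases h : IsFace G W' B
  · rw [toCochain_of_isFace h, ofCochain, Pi.zero_apply]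
    split_ifs with h1
    · rw [coeff_monomial, if_neg, smul_zero]
      intro h2
      replace h2 := sqfreeExp_injective h2
      refine hne ?_
      ext v
      have a1 := @h.1 v
      have a2 := @h1 v
      have a3 : v ∈ (B ∪ W'ᶜ) ∩ W ↔ v ∈ B := by rw [h2]
      simp only [Finset.mem_inter, Finset.mem_union, Finset.mem_compl] at a1 a2 a3
      tauto
    · rw [coeff_zero, smul_zero]
  · exact toCochain_of_not_isFace h _

theorem toCochain_sum_ofCochain {k : ℤ} {c : Finset V → Finset V → K}
    (hc : ∀ W, c W ∈ cochains K G W (k - Fintype.card V + W.card)) (W : Finset V) :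
    toCochain K G W (∑ W', ofCochain W' (c W')) = c W := by
  rw [map_sum, Finset.sum_eq_single W, toCochain_ofCochain_self (hc W)]
  · exact fun W' _ hne => toCochain_ofCochain_of_ne hne.symm _
  · exact fun h => absurd (Finset.mem_univ _) h

end Multidegree

section Homotopy

variable {K V : Type*} [Field K] [LinearOrder V]

/-- Division by the variable `X v` on the span of the monomials divisible by `X v ^ 2`; the other
monomials are sent to zero. This does not change the support of a monomial. -/
noncomputable def divVar (v : V) : MvPolynomial V K →ₗ[K] MvPolynomial V K where
  toFun g := X v * g.divMonomial (Finsupp.single v 2)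
  map_add' f g := by rw [add_divMonomial, mul_add]
  map_smul' c f := by
    rw [RingHom.id_apply, ← mul_smul_comm]
    congr 1
    ext μ
    simp only [coeff_divMonomial, coeff_smul]

theorem coeff_divVar (v : V) (g : MvPolynomial V K) (μ : V →₀ ℕ) :
    coeff μ (divVar v g) = if μ v = 0 then 0 else coeff (μ + Finsupp.single v 1) g := by
  change coeff μ (X v * g.divMonomial (Finsupp.single v 2)) = _
  rw [coeff_X_mul']
  by_cases h : μ v = 0
  · rw [if_pos h, if_neg (by simpa using h)]
  · rw [if_neg h, if_pos (by simpa using h), coeff_divMonomial]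
    congr 1
    ext w
    simp only [Finsupp.add_apply, Finsupp.tsub_apply, Finsupp.single_apply]
    split_ifs with hw
    · subst hw; omega
    · omega

theorem coeff_divVar_X_mul (v : V) (g : MvPolynomial V K) (μ : V →₀ ℕ) :
    coeff μ (divVar v (X v * g)) = if μ v = 0 then 0 else coeff μ g := by
  rw [coeff_divVar, add_comm, coeff_X_mul]

theorem coeff_X_mul_divVar (v : V) (g : MvPolynomial V K) (μ : V →₀ ℕ) :
    coeff μ (X v * divVar v g) = if μ v ≤ 1 then 0 else coeff μ g := by
  rw [coeff_X_mul', coeff_divVar]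
  by_cases h0 : μ v = 0
  · rw [if_neg (by simpa using h0), if_pos (by omega)]
  · rw [if_pos (by simpa using h0)]
    have h1 : (μ - Finsupp.single v 1 : V →₀ ℕ) v = μ v - 1 := by simp
    have h2 : μ - Finsupp.single v 1 + Finsupp.single v 1 = μ := by
      ext w
      simp only [Finsupp.add_apply, Finsupp.tsub_apply, Finsupp.single_apply]
      split_ifs with hw
      · subst hw; omega
      · omega
    rw [h1, h2]
    by_cases h3 : μ v ≤ 1
    · rw [if_pos h3, if_pos (by omega)]
    · rw [if_neg h3, if_neg (by omega)]

theorem divVar_X_mul {u v : V} (huv : u ≠ v) (g : MvPolynomial V K) :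
    divVar v (X u * g) = X u * divVar v g := by
  ext μ
  rw [coeff_divVar, coeff_X_mul', coeff_X_mul', coeff_divVar]
  have h1 : (μ + Finsupp.single v 1 : V →₀ ℕ) u = μ u := by simp [huv.symm]
  have h2 : (μ - Finsupp.single u 1 : V →₀ ℕ) v = μ v := by simp [huv]
  have h3 : μ + Finsupp.single v 1 - Finsupp.single u 1 =
      μ - Finsupp.single u 1 + Finsupp.single v 1 := by
    ext w
    simp only [Finsupp.add_apply, Finsupp.tsub_apply, Finsupp.single_apply]
    by_cases hw : u = w
    · subst hw
      simp [huv.symm]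
    · simp [hw]
  simp only [Finsupp.mem_support_iff, h1, h2, h3]
  split_ifs <;> rfl

/-- The contracting homotopy that removes the multidegrees with exponent at least two at `v`. -/
noncomputable def koszulHomotopy (v : V) (f : Finset V → MvPolynomial V K) :
    Finset V → MvPolynomial V K :=
  fun T => if v ∈ T then 0 else insertSign v T • divVar v (f (insert v T))

theorem koszulHomotopy_mem {v : V} {k : ℤ} {f : Finset V → MvPolynomial V K}
    (hf : f ∈ koszulChains K V (MvPolynomial V K) k) :
    koszulHomotopy v f ∈ koszulChains K V (MvPolynomial V K) (k - 1) := by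
  intro T hT
  unfold koszulHomotopy at hT
  split_ifs at hT with h
  · exact absurd rfl hT
  · have h1 : f (insert v T) ≠ 0 := fun h0 => hT (by rw [h0, map_zero, smul_zero])
    have := hf _ h1
    rw [Finset.card_insert_of_notMem h] at this
    push_cast at this
    omega

/-- The multidegree of a monomial with exponents `μ` over the set `T` has the exponent
`μ v + [v ∉ T]` at `v`; the homotopy identity holds where this is at least two. -/
theorem coeff_koszulHomotopy (v : V) (f : Finset V → MvPolynomial V K) (T : Finset V)
    (μ : V →₀ ℕ) :
    coeff μ (koszul K V (MvPolynomial V K) (koszulHomotopy v f) T +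
      koszulHomotopy v (koszul K V (MvPolynomial V K) f) T) =
      if μ v ≤ (if v ∈ T then 1 else 0) then 0 else coeff μ (f T) := by
  by_cases hv : v ∈ T
  · rw [if_pos hv, koszulHomotopy, if_pos hv, add_zero, koszul_apply, ← Finset.add_sum_erase _ _ hv,
      Finset.sum_eq_zero, add_zero, koszulHomotopy, if_neg (Finset.notMem_erase v T),
      Finset.insert_erase hv, smul_comm (X v : MvPolynomial V K), smul_smul, Int.units_mul_self,
      one_smul, smul_eq_mul, coeff_X_mul_divVar]
    intro u hu
    rw [koszulHomotopy, if_pos (Finset.mem_erase.mpr ⟨(Finset.mem_erase.mp hu).1.symm, hv⟩),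
      smul_zero, smul_zero]
  · have key : koszul K V (MvPolynomial V K) (koszulHomotopy v f) T +
        koszulHomotopy v (koszul K V (MvPolynomial V K) f) T = divVar v (X v * f T) := by
      rw [koszulHomotopy, if_neg hv, koszul_apply, koszul_apply, Finset.sum_insert hv,
        Finset.erase_insert hv, map_add, map_sum, smul_add, Finset.smul_sum,
        LinearMap.map_smul_of_tower (divVar v) (_ : ℤˣ), smul_smul, Int.units_mul_self, one_smul,
        smul_eq_mul, add_left_comm, ← Finset.sum_add_distrib, Finset.sum_eq_zero, add_zero]
      intro u hu
      have huv : u ≠ v := by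
        rintro rfl
        exact hv hu
      have h1 : (insert v T).erase u = insert v (T.erase u) :=
        Finset.erase_insert_of_ne huv.symm
      have h2 : v ∉ T.erase u := fun h => hv (Finset.mem_of_mem_erase h)
      have hsign := insertSign_mul_insertSign huv (Finset.notMem_erase u T) h2
      rw [Finset.insert_erase hu] at hsign
      have hsign' : insertSign v T * insertSign u (insert v (T.erase u)) =
          -(insertSign u (T.erase u) * insertSign v (T.erase u)) := by
        have h3 := congrArg (fun s => insertSign u (T.erase u) * s *
          insertSign u (insert v (T.erase u))) hsign
        simp only [mul_neg, neg_mul] at h3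
        rw [← mul_assoc, Int.units_mul_self, one_mul, mul_assoc, mul_assoc (insertSign v _),
          Int.units_mul_self, mul_one] at h3
        exact h3
      rw [koszulHomotopy, if_neg h2, h1, LinearMap.map_smul_of_tower (divVar v) (_ : ℤˣ), smul_smul,
        hsign', smul_eq_mul, smul_eq_mul, divVar_X_mul huv, mul_smul_comm, smul_smul,
        Units.neg_smul, add_neg_cancel]
    rw [key, if_neg hv, coeff_divVar_X_mul]
    simp only [Nat.le_zero]

end Homotopy

/-! ### Koszul homology of a Stanley–Reisner ring -/

section Hochster

variable {K V : Type*} [Field K] [LinearOrder V] {G : SimpleGraph V}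
  {I : Ideal (MvPolynomial V K)}
  (hI : ∀ f, f ∈ I ↔ ∀ μ ∈ f.support, ¬G.IsIndepSet (μ.support : Set V))

include hI in
theorem koszulHomotopy_apply_mem {f : Finset V → MvPolynomial V K} (hf : ∀ T, f T ∈ I) (v : V)
    (T : Finset V) : koszulHomotopy v f T ∈ I := by
  unfold koszulHomotopy
  split_ifs with h
  · exact zero_mem _
  · rw [Units.smul_def]
    refine zsmul_mem ((hI _).mpr fun μ hμ hind => ?_) _
    rw [mem_support_iff, coeff_divVar] at hμ
    split_ifs at hμ with h0
    · exact hμ rfl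
    · refine (hI _).mp (hf _) _ (mem_support_iff.mpr hμ) ?_
      have : (μ + Finsupp.single v 1).support = μ.support := by
        ext w
        rw [Finsupp.mem_support_iff, Finsupp.mem_support_iff, Finsupp.add_apply]
        by_cases hw : w = v
        · subst hw
          simp [h0]
        · simp [Ne.symm hw]
      rwa [this]

include hI in
/-- Modulo boundaries and modulo the ideal, a Koszul cycle of the quotient may be assumed to live
in multidegrees that are square-free at the vertices in `U`. -/
theorem exists_koszul_sqfree {k : ℤ} {f : Finset V → MvPolynomial V K}
    (hf : f ∈ koszulChains K V (MvPolynomial V K) k)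
    (hfI : ∀ T, koszul K V (MvPolynomial V K) f T ∈ I) (U : Finset V) :
    ∃ g ∈ koszulChains K V (MvPolynomial V K) (k - 1), ∃ e : Finset V → MvPolynomial V K,
      (∀ T, e T ∈ I) ∧
      f - koszul K V (MvPolynomial V K) g - e ∈ koszulChains K V (MvPolynomial V K) k ∧
      ∀ T, ∀ μ ∈ ((f - koszul K V (MvPolynomial V K) g - e) T).support, ∀ v ∈ U,
        μ v ≤ if v ∈ T then 1 else 0 := by
  induction U using Finset.induction_on with
  | empty => exact ⟨0, zero_mem _, 0, fun T => zero_mem _, by simpa using hf, by simp⟩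
  | insert v U _ ih =>
    obtain ⟨g, hg, e, he, hc, hU⟩ := ih
    set f₁ := f - koszul K V (MvPolynomial V K) g - e with hf₁
    have hf₁I : ∀ T, koszul K V (MvPolynomial V K) f₁ T ∈ I := by
      intro T
      rw [hf₁, map_sub, map_sub, koszul_koszul, sub_zero]
      exact sub_mem (hfI T) (koszul_apply_mem he T)
    have heq : f - koszul K V (MvPolynomial V K) (g + koszulHomotopy v f₁) -
        (e + koszulHomotopy v (koszul K V (MvPolynomial V K) f₁)) =
        f₁ - (koszul K V (MvPolynomial V K) (koszulHomotopy v f₁) +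
          koszulHomotopy v (koszul K V (MvPolynomial V K) f₁)) := by
      rw [map_add, hf₁]
      abel
    refine ⟨g + koszulHomotopy v f₁, add_mem hg (koszulHomotopy_mem hc),
      e + koszulHomotopy v (koszul K V (MvPolynomial V K) f₁),
      fun T => add_mem (he T) (koszulHomotopy_apply_mem hI hf₁I v T), ?_, ?_⟩
    · rw [heq]
      have h1 := koszul_mem_koszulChains (koszulHomotopy_mem (v := v) hc)
      have h2 := koszulHomotopy_mem (v := v) (koszul_mem_koszulChains hc)
      rw [sub_add_cancel] at h1
      rw [add_sub_cancel_right] at h2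
      exact sub_mem hc (add_mem h1 h2)
    · rw [heq]
      intro T μ hμ w hw
      rw [mem_support_iff, Pi.sub_apply, Pi.add_apply, coeff_sub, coeff_koszulHomotopy] at hμ
      by_cases h : μ v ≤ if v ∈ T then 1 else 0
      · rw [if_pos h, sub_zero] at hμ
        rcases Finset.mem_insert.mp hw with rfl | hw
        · exact h
        · exact hU T μ (mem_support_iff.mpr hμ) w hw
      · exact absurd (by rw [if_neg h, sub_self]) hμ

/-- All multidegrees of the Koszul chain `f` are square-free. -/
def IsSqfree (f : Finset V → MvPolynomial V K) : Prop :=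
  ∀ T, ∀ μ ∈ (f T).support, ∀ v, μ v ≤ if v ∈ T then 1 else 0

theorem IsSqfree.koszul {f : Finset V → MvPolynomial V K} (hf : IsSqfree f) :
    IsSqfree (koszul K V (MvPolynomial V K) f) := by
  intro T μ hμ v
  rw [mem_support_iff, koszul_apply, coeff_sum] at hμ
  obtain ⟨u, hu, hne⟩ := Finset.exists_ne_zero_of_sum_ne_zero hμ
  rw [coeff_units_smul, smul_eq_mul, coeff_X_mul'] at hne
  split_ifs at hne with h
  · have h1 := hf _ _ (mem_support_iff.mpr fun h0 => hne (by rw [h0, smul_zero])) v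
    rw [Finsupp.tsub_apply] at h1
    by_cases hv : v = u
    · subst hv
      simp only [Finsupp.single_eq_same, Finset.notMem_erase, if_false] at h1
      rw [if_pos hu]
      omega
    · simpa [Finset.mem_erase, hv, Finsupp.single_apply, Ne.symm hv] using h1
  · exact absurd (smul_zero _) hne

theorem IsSqfree.sub {f g : Finset V → MvPolynomial V K} (hf : IsSqfree f) (hg : IsSqfree g) :
    IsSqfree (f - g) := by
  intro T μ hμ v
  rw [mem_support_iff, Pi.sub_apply, coeff_sub] at hμ
  by_cases h : coeff μ (f T) = 0
  · exact hg T μ (mem_support_iff.mpr fun h0 => hμ (by rw [h, h0, sub_zero])) v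
  · exact hf T μ (mem_support_iff.mpr h) v

theorem IsSqfree.sum {ι : Type*} {s : Finset ι} {f : ι → Finset V → MvPolynomial V K}
    (hf : ∀ i ∈ s, IsSqfree (f i)) : IsSqfree (∑ i ∈ s, f i) := by
  intro T μ hμ v
  rw [mem_support_iff, Finset.sum_apply, coeff_sum] at hμ
  obtain ⟨i, hi, hne⟩ := Finset.exists_ne_zero_of_sum_ne_zero hμ
  exact hf i hi T μ (mem_support_iff.mpr hne) v

variable [Fintype V]

theorem isSqfree_ofCochain (W : Finset V) (c : Finset V → K) : IsSqfree (ofCochain W c) := by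
  intro T μ hμ v
  rw [mem_support_iff, ofCochain] at hμ
  split_ifs at hμ with h
  · rw [coeff_monomial] at hμ
    split_ifs at hμ with h1
    · rw [← h1, sqfreeExp_apply]
      simp only [Finset.mem_inter]
      split_ifs <;> first | omega | tauto
    · exact absurd rfl hμ
  · exact absurd (coeff_zero _) hμ

include hI in
/-- A Koszul chain in square-free multidegrees vanishes modulo the ideal if its components do. -/
theorem IsSqfree.apply_mem {f : Finset V → MvPolynomial V K} (hf : IsSqfree f)
    (h0 : ∀ W, toCochain K G W f = 0) (T : Finset V) : f T ∈ I := by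
  refine (hI _).mpr fun μ hμ hind => ?_
  have h1 := hf T μ hμ
  have hsub : μ.support ⊆ T := by
    intro v hv
    by_contra hvT
    have := h1 v
    rw [if_neg hvT] at this
    exact Finsupp.mem_support_iff.mp hv (Nat.le_zero.mp this)
  have hμ1 : μ = sqfreeExp μ.support := eq_sqfreeExp fun v => (h1 v).trans (by split_ifs <;> omega)
  have hface : IsFace G (μ.support ∪ Tᶜ) μ.support := ⟨Finset.subset_union_left, hind⟩
  have hT : μ.support ∪ (μ.support ∪ Tᶜ)ᶜ = T := by
    ext v
    have := @hsub v
    simp only [Finset.mem_union, Finset.mem_compl]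
    tauto
  have h2 := congrFun (h0 (μ.support ∪ Tᶜ)) μ.support
  rw [toCochain_of_isFace hface, hT, ← hμ1, Pi.zero_apply] at h2
  rw [mem_support_iff] at hμ
  rcases Int.units_eq_one_or (twistSign (μ.support ∪ Tᶜ) μ.support) with h3 | h3 <;>
    rw [h3] at h2 <;> simp at h2 <;> exact hμ h2

include hI in
theorem exists_koszul_of_toCochain_mem {k : ℤ} {f : Finset V → MvPolynomial V K}
    (hf : f ∈ koszulChains K V (MvPolynomial V K) k)
    (hfI : ∀ T, koszul K V (MvPolynomial V K) f T ∈ I)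
    (h : ∀ W, toCochain K G W f ∈ coboundaries K G W (k - Fintype.card V + W.card)) :
    ∃ g ∈ koszulChains K V (MvPolynomial V K) (k - 1),
      ∀ T, f T - koszul K V (MvPolynomial V K) g T ∈ I := by
  obtain ⟨g, hg, e, he, hc, hU⟩ := exists_koszul_sqfree hI hf hfI Finset.univ
  set f₁ := f - koszul K V (MvPolynomial V K) g - e with hf₁
  have hsq : IsSqfree f₁ := fun T μ hμ v => hU T μ hμ v (Finset.mem_univ v)
  choose c hc hcf using h
  have hidx : ∀ W : Finset V, k - Fintype.card V + W.card - 1 = k - 1 - Fintype.card V + W.card :=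
    fun W => by ring
  have hc' : ∀ W, c W - toCochain K G W g ∈
      cochains K G W (k - 1 - Fintype.card V + W.card) := fun W =>
    sub_mem (hidx W ▸ hc W) (toCochain_mem_cochains hg)
  set g' := ∑ W, ofCochain W (c W - toCochain K G W g) with hg'
  refine ⟨g + g', add_mem hg (sum_mem fun W _ => ofCochain_mem_koszulChains (hc' W)), fun T => ?_⟩
  have hsq' : IsSqfree (f₁ - koszul K V (MvPolynomial V K) g') :=
    hsq.sub (IsSqfree.sum fun W _ => isSqfree_ofCochain W _).koszul
  have hmem := hsq'.apply_mem hI (fun W => by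
    rw [map_sub, ← cobd_toCochain, hg', toCochain_sum_ofCochain hc', hf₁, map_sub, map_sub,
      ← cobd_toCochain, ← hcf, toCochain_eq_zero hI he, map_sub]
    abel) T
  have : f T - koszul K V (MvPolynomial V K) (g + g') T =
      (f₁ - koszul K V (MvPolynomial V K) g') T + e T := by
    rw [map_add, hf₁]
    simp only [Pi.sub_apply, Pi.add_apply]
    ring
  rw [this]
  exact add_mem hmem (he T)

include hI in
/-- Hochster's formula: the Koszul homology of the Stanley–Reisner ring is the direct sum of the
reduced cohomologies of the independence complexes of the induced subgraphs. -/
theorem koszulDim_quotient (k : ℤ) :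
    koszulDim K V (MvPolynomial V K ⧸ I) k =
      ∑ W : Finset V, cohDim K G W (k - Fintype.card V + W.card) := by
  have hmk : Function.Surjective (I.mkQ) := Submodule.mkQ_surjective I
  have hmk0 : ∀ x, I.mkQ x = 0 ↔ x ∈ I := fun x => Submodule.Quotient.mk_eq_zero I
  let a : (Finset V → MvPolynomial V K) →ₗ[K] (Finset V → MvPolynomial V K ⧸ I) :=
    (I.mkQ.restrictScalars K).compLeft (Finset V)
  have ha : ∀ f T, a f T = I.mkQ (f T) := fun _ _ => rfl
  have hka : ∀ f, koszul K V (MvPolynomial V K ⧸ I) (a f) =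
      a (koszul K V (MvPolynomial V K) f) := fun f => by
    funext T
    exact koszul_naturality I.mkQ f T
  have ha0 : ∀ f, a f = 0 ↔ ∀ T, f T ∈ I := fun f => by
    rw [funext_iff]
    exact forall_congr' fun T => hmk0 _
  let b : (Finset V → MvPolynomial V K) →ₗ[K] (Finset V → Finset V → K) :=
    LinearMap.pi fun W => toCochain K G W
  rw [koszulDim]
  refine Eq.trans ?_ (quotDim_pi fun W =>
    coboundaries_le_cocycles (K := K) (G := G) W (k - Fintype.card V + W.card))
  -- The polynomial chains that are cycles modulo `I` correspond both to the cycles of the quotient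
  -- and to the families of their square-free components.
  refine quotDim_eq_of_correspondence
    (koszulChains K V (MvPolynomial V K) k ⊓ LinearMap.ker (a ∘ₗ koszul K V (MvPolynomial V K)))
    a b ?_ ?_ ?_ ?_ ?_
  · rintro f ⟨hf, hf0⟩
    exact ⟨map_mem_koszulChains (π := I.mkQ) (map_zero _) hf, (hka f).trans hf0⟩
  · rintro f ⟨hf, hf0⟩ W -
    refine ⟨toCochain_mem_cochains hf, ?_⟩
    change cobd K G W (toCochain K G W f) = 0
    rw [cobd_toCochain, toCochain_eq_zero hI ((ha0 _).mp hf0)]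
  · rintro p ⟨hp, hp0⟩
    obtain ⟨f, hf, hfp⟩ := exists_koszulChains_lift (map_zero I.mkQ) hmk hp
    have hfp' : a f = p := funext hfp
    refine ⟨f, ⟨hf, ?_⟩, by rw [hfp', sub_self]; exact zero_mem _⟩
    change a (koszul K V (MvPolynomial V K) f) = 0
    rw [← hka, hfp']
    exact hp0
  · intro c hc
    have hc1 : ∀ W, c W ∈ cochains K G W (k - Fintype.card V + W.card) := fun W =>
      (hc W trivial).1
    have hc2 : ∀ W, cobd K G W (c W) = 0 := fun W => (hc W trivial).2
    refine ⟨∑ W, ofCochain W (c W),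
      ⟨sum_mem fun W _ => ofCochain_mem_koszulChains (hc1 W), ?_⟩, ?_⟩
    · refine (ha0 _).mpr fun T => (IsSqfree.sum fun W _ => isSqfree_ofCochain W _).koszul.apply_mem
        hI (fun W => ?_) T
      rw [← cobd_toCochain, toCochain_sum_ofCochain hc1, hc2]
    · have : b (∑ W, ofCochain W (c W)) = c := funext fun W => toCochain_sum_ofCochain hc1 W
      rw [this, sub_self]
      exact zero_mem _
  · rintro f ⟨hf, hf0⟩
    constructor
    · rintro ⟨g, hg, hgf⟩ W -
      obtain ⟨g, hgc, rfl⟩ : ∃ g' ∈ koszulChains K V (MvPolynomial V K) (k - 1), a g' = g := by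
        obtain ⟨g', hg', h⟩ := exists_koszulChains_lift (map_zero I.mkQ) hmk hg
        exact ⟨g', hg', funext h⟩
      rw [hka, ← sub_eq_zero, ← map_sub] at hgf
      have h1 := toCochain_eq_zero hI ((ha0 _).mp hgf) W
      rw [map_sub, ← cobd_toCochain, sub_eq_zero] at h1
      refine ⟨toCochain K G W g, ?_, h1⟩
      have := toCochain_mem_cochains (G := G) (W := W) hgc
      rwa [show k - Fintype.card V + W.card - 1 = k - 1 - Fintype.card V + (W.card : ℤ) by ring]
    · intro h
      obtain ⟨g, hg, hgf⟩ := exists_koszul_of_toCochain_mem hI hf ((ha0 _).mp hf0)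
        fun W => h W trivial
      refine ⟨a g, map_mem_koszulChains (π := I.mkQ) (map_zero _) hg, ?_⟩
      rw [hka, eq_comm, ← sub_eq_zero, ← map_sub]
      exact (ha0 _).mpr hgf

/-- The Koszul complex of the polynomial ring is exact, except for the constants in homological
degree zero: its components are cohomologies of simplices. -/
theorem mem_koszulBoundaries_polynomial {k : ℤ} {f : Finset V → MvPolynomial V K}
    (hf : f ∈ koszulCycles K V (MvPolynomial V K) k)
    (h0 : constantCoeff (f Finset.univ) = 0) :
    f ∈ koszulBoundaries K V (MvPolynomial V K) k := by
  have hbot : ∀ f, f ∈ (⊥ : Ideal (MvPolynomial V K)) ↔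
      ∀ μ ∈ f.support, ¬(⊥ : SimpleGraph V).IsIndepSet (μ.support : Set V) := by
    intro f
    have hind : ∀ s : Set V, (⊥ : SimpleGraph V).IsIndepSet s := fun s => by
      intro x _ y _ _ h
      exact h
    simp only [hind, not_true_eq_false, imp_false, Ideal.mem_bot]
    rw [← support_eq_empty, Finset.eq_empty_iff_forall_notMem]
  obtain ⟨hf, hf0⟩ := hf
  replace hf0 : koszul K V (MvPolynomial V K) f = 0 := hf0
  obtain ⟨g, hg, hfg⟩ := exists_koszul_of_toCochain_mem hbot hf (fun T => by simp [hf0])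
    (fun W => by
      rcases W.eq_empty_or_nonempty with rfl | ⟨w, hw⟩
      · have : toCochain K (⊥ : SimpleGraph V) ∅ f = 0 := by
          funext B
          by_cases hB : IsFace (⊥ : SimpleGraph V) ∅ B
          · obtain rfl := Finset.subset_empty.mp hB.1
            have h1 : sqfreeExp (∅ : Finset V) = 0 := by
              ext v
              simp [sqfreeExp_apply]
            rw [toCochain_of_isFace hB, h1, Finset.compl_empty, Finset.empty_union]
            rw [constantCoeff_eq] at h0
            rw [h0, smul_zero, Pi.zero_apply]
          · exact toCochain_of_not_isFace hB f
        rw [this]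
        exact zero_mem _
      · refine acyclic_of_isolated hw (fun w _ h => h) _ ⟨toCochain_mem_cochains hf, ?_⟩
        change cobd K _ W (toCochain K _ W f) = 0
        rw [cobd_toCochain, hf0, map_zero])
  exact ⟨g, hg, funext fun T => (sub_eq_zero.mp ((Ideal.mem_bot).mp (hfg T))).symm⟩

end Hochster

/-! ### Betti numbers as dimensions of Koszul homology -/

section Resolution

universe u v

variable {K : Type u} {V : Type v} [Field K] [LinearOrder V]

theorem constantCoeff_koszul {ι : Type*} (g : Finset V → ι →₀ MvPolynomial V K) (T : Finset V)
    (a : ι) : constantCoeff (koszul K V (ι →₀ MvPolynomial V K) g T a) = 0 := by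
  rw [koszul_apply, Finsupp.finsetSum_apply, map_sum]
  refine Finset.sum_eq_zero fun w _ => ?_
  rcases Int.units_eq_one_or (insertSign w (T.erase w)) with h | h <;> rw [h] <;> simp

variable [Fintype V]

/-- The Koszul complex of a free module is exact, except for the constants in homological degree
zero. -/
theorem mem_koszulBoundaries_free {ι : Type*} [Finite ι] {k : ℤ}
    {f : Finset V → ι →₀ MvPolynomial V K}
    (hf : f ∈ koszulCycles K V (ι →₀ MvPolynomial V K) k)
    (h0 : ∀ a, constantCoeff (f Finset.univ a) = 0) :
    f ∈ koszulBoundaries K V (ι →₀ MvPolynomial V K) k := by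
  obtain ⟨hf, hf0⟩ := hf
  replace hf0 : koszul K V _ f = 0 := hf0
  have hcoord : ∀ (g : Finset V → ι →₀ MvPolynomial V K) (a : ι) (T : Finset V),
      koszul K V (MvPolynomial V K) (fun T => g T a) T = koszul K V _ g T a := fun g a T =>
    koszul_naturality (Finsupp.lapply a) g T
  have key : ∀ a, ∃ g ∈ koszulChains K V (MvPolynomial V K) (k - 1),
      koszul K V (MvPolynomial V K) g = fun T => f T a := fun a =>
    mem_koszulBoundaries_polynomial (f := fun T => f T a)
      ⟨map_mem_koszulChains (π := fun x : ι →₀ MvPolynomial V K => x a) rfl hf, by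
        change koszul K V (MvPolynomial V K) (fun T => f T a) = 0
        funext T
        rw [hcoord, hf0]
        rfl⟩ (h0 a)
  choose g hg hgf using key
  refine ⟨fun T => Finsupp.equivFunOnFinite.symm fun a => g a T, fun T hT => ?_, ?_⟩
  · obtain ⟨a, ha⟩ := Finsupp.ne_iff.mp hT
    exact hg a T ha
  · funext T
    ext1 a
    rw [← hcoord]
    exact congrFun (hgf a) T

/-- Dimension shifting along the first step of a minimal resolution. -/
theorem koszulDim_of_exact {ι : Type*} [Finite ι] {M : Type*} [AddCommGroup M]
    [Module (MvPolynomial V K) M] [Module K M] [IsScalarTower K (MvPolynomial V K) M]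
    {N : Type*} [AddCommGroup N] [Module (MvPolynomial V K) N] [Module K N]
    [IsScalarTower K (MvPolynomial V K) N]
    {π : (ι →₀ MvPolynomial V K) →ₗ[MvPolynomial V K] M} (hπ : Function.Surjective π)
    {j : N →ₗ[MvPolynomial V K] (ι →₀ MvPolynomial V K)} (hj : Function.Injective j)
    (hexact : Function.Exact j π)
    (hmin : ∀ x, π x = 0 → ∀ a, constantCoeff (x a) = 0) {k : ℤ} (hk : k < Fintype.card V) :
    koszulDim K V M k = koszulDim K V N (k + 1) := by
  let a : (Finset V → ι →₀ MvPolynomial V K) →ₗ[K] (Finset V → M) :=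
    (π.restrictScalars K).compLeft (Finset V)
  let e : (Finset V → N) →ₗ[K] (Finset V → ι →₀ MvPolynomial V K) :=
    (j.restrictScalars K).compLeft (Finset V)
  have hka : ∀ f, koszul K V M (a f) = a (koszul K V _ f) := fun f => by
    funext T
    exact koszul_naturality π f T
  have hke : ∀ f, koszul K V _ (e f) = e (koszul K V _ f) := fun f => by
    funext T
    exact koszul_naturality j f T
  have he : Function.Injective e := fun x y h => funext fun T => hj (congrFun h T)
  have hae : ∀ n, a (e n) = 0 := fun n => funext fun T => hexact.apply_apply_eq_zero (n T)
  have hea : ∀ f, a f = 0 → ∃ n, e n = f := fun f hf => by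
    choose n hn using fun T => (hexact (f T)).mp (congrFun hf T)
    exact ⟨n, funext hn⟩
  have hec : ∀ {n : Finset V → N} {l : ℤ}, e n ∈ koszulChains K V _ l ↔
      n ∈ koszulChains K V _ l := fun {n l} => by
    constructor
    · exact fun h T hT => h T fun h0 => hT (hj (h0.trans (map_zero j).symm))
    · exact fun h => map_mem_koszulChains (π := j) (map_zero j) h
  -- A cycle over `M` corresponds to the Koszul differential of a lift of it to the free module.
  refine quotDim_eq_of_correspondence
    (((koszulChains K V (ι →₀ MvPolynomial V K) k).prod
        (koszulChains K V N (k + 1))) ⊓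
      LinearMap.ker (koszul K V _ ∘ₗ LinearMap.fst K _ _ - e ∘ₗ LinearMap.snd K _ _))
    (a ∘ₗ LinearMap.fst K _ _) (LinearMap.snd K _ _) ?_ ?_ ?_ ?_ ?_
  · rintro ⟨f, n⟩ ⟨⟨hf, -⟩, hfn⟩
    replace hfn : koszul K V _ f = e n := sub_eq_zero.mp hfn
    refine ⟨map_mem_koszulChains (π := π) (map_zero _) hf, ?_⟩
    change koszul K V M (a f) = 0
    rw [hka, hfn, hae]
  · rintro ⟨f, n⟩ ⟨⟨-, hn⟩, hfn⟩
    replace hfn : koszul K V _ f = e n := sub_eq_zero.mp hfn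
    refine ⟨hn, he ?_⟩
    change e (koszul K V _ n) = e 0
    rw [← hke, ← hfn, koszul_koszul, map_zero]
  · rintro p ⟨hp, hp0⟩
    obtain ⟨f, hf, hfp⟩ := exists_koszulChains_lift (map_zero π) hπ hp
    have hfp' : a f = p := funext hfp
    obtain ⟨n, hn⟩ := hea (koszul K V _ f) (by rw [← hka, hfp']; exact hp0)
    refine ⟨(f, n), ⟨⟨hf, hec.mp ?_⟩, sub_eq_zero.mpr hn.symm⟩, ?_⟩
    · rw [hn]
      exact koszul_mem_koszulChains hf
    · change p - a f ∈ _
      rw [hfp', sub_self]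
      exact zero_mem _
  · rintro n ⟨hn, hn0⟩
    replace hn0 : koszul K V _ n = 0 := hn0
    obtain ⟨f, hf, hfn⟩ := mem_koszulBoundaries_free (f := e n) ⟨hec.mpr hn, by
      change koszul K V _ (e n) = 0
      rw [hke, hn0, map_zero]⟩ (hmin _ (hexact.apply_apply_eq_zero _))
    refine ⟨(f, n), ⟨⟨?_, hn⟩, sub_eq_zero.mpr hfn⟩, ?_⟩
    · rwa [add_sub_cancel_right] at hf
    · change n - n ∈ _
      rw [sub_self]
      exact zero_mem _
  · rintro ⟨f, n⟩ ⟨⟨hf, hn⟩, hfn⟩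
    replace hfn : koszul K V _ f = e n := sub_eq_zero.mp hfn
    change a f ∈ koszulBoundaries K V M k ↔ n ∈ koszulBoundaries K V _ (k + 1)
    constructor
    · rintro ⟨g, hg, hgf⟩
      obtain ⟨g', hg', h⟩ := exists_koszulChains_lift (map_zero π) hπ hg
      obtain rfl : a g' = g := funext h
      obtain ⟨m, hm⟩ := hea (f - koszul K V _ g') (by rw [map_sub, ← hka, hgf, sub_self])
      refine ⟨m, hec.mp ?_, he ?_⟩
      · have := koszul_mem_koszulChains hg'
        rw [sub_add_cancel] at this
        rw [hm, add_sub_cancel_right]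
        exact sub_mem hf this
      · rw [← hke, hm, map_sub, koszul_koszul, sub_zero, hfn]
    · rintro ⟨m, hm, hmn⟩
      rw [add_sub_cancel_right] at hm
      have hcyc : f - e m ∈ koszulCycles K V (ι →₀ MvPolynomial V K) k := by
        refine ⟨sub_mem hf (hec.mpr hm), ?_⟩
        change koszul K V _ (f - e m) = 0
        rw [map_sub, hke, hmn, hfn, sub_self]
      obtain ⟨g, hg, hgf⟩ := mem_koszulBoundaries_free hcyc fun a => by
        rw [koszulChains_eq_zero hcyc.1 (by rw [Finset.card_univ]; exact hk.ne'),
          Finsupp.zero_apply, map_zero]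
      refine ⟨a g, map_mem_koszulChains (π := π) (map_zero _) hg, ?_⟩
      rw [hka, hgf, map_sub, hae, sub_zero]

/-- In homological degree zero the Koszul homology counts minimal generators. -/
theorem koszulDim_card {ι : Type*} [Finite ι] {M : Type*} [AddCommGroup M]
    [Module (MvPolynomial V K) M] [Module K M] [IsScalarTower K (MvPolynomial V K) M]
    {π : (ι →₀ MvPolynomial V K) →ₗ[MvPolynomial V K] M} (hπ : Function.Surjective π)
    (hmin : ∀ x, π x = 0 → ∀ a, constantCoeff (x a) = 0) :
    koszulDim K V M (Fintype.card V) = Nat.card ι := by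
  have := Fintype.ofFinite ι
  let a : (Finset V → ι →₀ MvPolynomial V K) →ₗ[K] (Finset V → M) :=
    (π.restrictScalars K).compLeft (Finset V)
  let b : (Finset V → ι →₀ MvPolynomial V K) →ₗ[K] (ι → K) :=
    LinearMap.pi fun i => lcoeff K 0 ∘ₗ (Finsupp.lapply i : (ι →₀ MvPolynomial V K) →ₗ[K] _) ∘ₗ
      LinearMap.proj Finset.univ
  have hb : ∀ f i, b f i = constantCoeff (f Finset.univ i) := fun _ _ => rfl
  have hka : ∀ f, koszul K V M (a f) = a (koszul K V _ f) := fun f => by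
    funext T
    exact koszul_naturality π f T
  have htop : ∀ f ∈ koszulChains K V (ι →₀ MvPolynomial V K) (Fintype.card V),
      koszul K V _ f = 0 := fun f hf => by
    funext T
    refine koszulChains_eq_zero (koszul_mem_koszulChains hf) ?_
    have := Finset.card_le_univ T
    omega
  have hdim : quotDim (⊤ : Submodule K (ι → K)) ⊥ = Nat.card ι := by
    have h := quotDim_add_finrank (K := K) (P := (⊤ : Submodule K (ι → K))) (Q := ⊥) bot_le
    rw [finrank_bot, finrank_top, Module.finrank_fintype_fun_eq_card] at h
    rw [Nat.card_eq_fintype_card, ← h, add_zero]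
  rw [← hdim]
  refine quotDim_eq_of_correspondence
    (koszulChains K V (ι →₀ MvPolynomial V K) (Fintype.card V)) a b ?_ ?_ ?_ ?_ ?_
  · intro f hf
    refine ⟨map_mem_koszulChains (π := π) (map_zero _) hf, ?_⟩
    change koszul K V M (a f) = 0
    rw [hka, htop f hf, map_zero]
  · exact fun _ _ => trivial
  · rintro p ⟨hp, -⟩
    obtain ⟨f, hf, hfp⟩ := exists_koszulChains_lift (map_zero π) hπ hp
    refine ⟨f, hf, ?_⟩
    rw [show a f = p from funext hfp, sub_self]
    exact zero_mem _
  · intro c _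
    refine ⟨fun T => if T = Finset.univ then Finsupp.equivFunOnFinite.symm fun i => C (c i) else 0,
      fun T hT => ?_, ?_⟩
    · by_cases h : T = Finset.univ
      · rw [h, Finset.card_univ]
      · exact absurd (if_neg h) hT
    · have : c - b (fun T => if T = Finset.univ then
          Finsupp.equivFunOnFinite.symm fun i => C (c i) else 0) = 0 := by
        funext i
        rw [Pi.sub_apply, hb]
        simp
      rw [this]
      exact zero_mem _
  · intro f hf
    rw [Submodule.mem_bot, funext_iff]
    constructor
    · rintro ⟨g, hg, hgf⟩ i
      obtain ⟨g', hg', h⟩ := exists_koszulChains_lift (map_zero π) hπ hg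
      obtain rfl : a g' = g := funext h
      rw [hka, ← sub_eq_zero, ← map_sub] at hgf
      have h1 := hmin _ (congrFun hgf Finset.univ) i
      rw [Pi.sub_apply, Finsupp.sub_apply, map_sub, constantCoeff_koszul, zero_sub,
        neg_eq_zero] at h1
      exact h1
    · intro h
      obtain ⟨g, hg, hgf⟩ := mem_koszulBoundaries_free ⟨hf, htop f hf⟩ h
      exact ⟨a g, map_mem_koszulChains (π := π) (map_zero _) hg, by rw [hka, hgf]⟩

/-- The Koszul homology in homological degree `i`, which is `Tor_i(M, K)`, counts the basis elements
of the `i`th free module of any minimal resolution of `M`. -/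
theorem koszulDim_eq_card_of_resolution (i : ℕ) {ι : ℕ → Type} [∀ j, Finite (ι j)]
    {M : Type max u v} [AddCommGroup M] [Module (MvPolynomial V K) M] [Module K M]
    [IsScalarTower K (MvPolynomial V K) M]
    (d : ∀ j, (ι (j + 1) →₀ MvPolynomial V K) →ₗ[MvPolynomial V K] (ι j →₀ MvPolynomial V K))
    (π : (ι 0 →₀ MvPolynomial V K) →ₗ[MvPolynomial V K] M) (hπ : Function.Surjective π)
    (hexact₀ : Function.Exact (d 0) π) (hexact : ∀ j, Function.Exact (d (j + 1)) (d j))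
    (hmin : ∀ j x a, constantCoeff (d j x a) = 0) :
    koszulDim K V M (Fintype.card V - i) = Nat.card (ι i) := by
  have hmin₀ : ∀ x, π x = 0 → ∀ a, constantCoeff (x a) = 0 := by
    intro x hx a
    obtain ⟨y, rfl⟩ := (hexact₀ x).mp hx
    exact hmin 0 y a
  induction i generalizing ι M with
  | zero =>
    rw [Nat.cast_zero, sub_zero]
    exact koszulDim_card hπ hmin₀
  | succ i ih =>
    rw [koszulDim_of_exact (N := LinearMap.ker π) (j := (LinearMap.ker π).subtype) hπ
      (LinearMap.ker π).subtype_injective (LinearMap.exact_subtype_ker_map π) hmin₀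
      (by push_cast; omega)]
    have hd : ∀ x, d 0 x ∈ LinearMap.ker π := fun x => (hexact₀ _).mpr ⟨x, rfl⟩
    have key := ih (ι := fun j => ι (j + 1)) (fun j => d (j + 1))
      ((d 0).codRestrict (LinearMap.ker π) hd)
      (fun y : LinearMap.ker π => by
        obtain ⟨x, hx⟩ := (hexact₀ y).mp y.2
        exact ⟨x, Subtype.ext hx⟩)
      (fun x => by
        rw [← hexact 0 x, ← LinearMap.codRestrict_apply (LinearMap.ker π) (d 0) x (h := hd)]
        exact ⟨fun h => congrArg Subtype.val h, fun h => Subtype.ext h⟩)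
      (fun j => hexact (j + 1)) (fun j => hmin (j + 1))
      (fun (x : ι 1 →₀ MvPolynomial V K) hx => by
        obtain ⟨y, rfl⟩ := (hexact 0 x).mp (congrArg Subtype.val hx)
        exact hmin 1 y)
    rw [← key]
    congr 1
    push_cast
    ring

end Resolution

section Betti

variable {K V : Type*} [Field K]

/-- The basis of a graded free module in terms of the finitely many degrees that occur. -/
def gradedBasisEquiv (b : ℕ →₀ ℕ) : (Σ j : ℕ, Fin (b j)) ≃ Σ j : b.support, Fin (b j) where
  toFun x := ⟨⟨x.1, Finsupp.mem_support_iff.mpr fun h => (h ▸ x.2).elim0⟩, x.2⟩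
  invFun x := ⟨x.1.1, x.2⟩
  left_inv _ := rfl
  right_inv _ := rfl

instance finite_gradedBasis (b : ℕ →₀ ℕ) : Finite (Σ j : ℕ, Fin (b j)) :=
  Finite.of_equiv _ (gradedBasisEquiv b).symm

theorem card_gradedBasis (b : ℕ →₀ ℕ) :
    Nat.card (Σ j : ℕ, Fin (b j)) = b.sum fun _ n => n := by
  rw [Nat.card_congr (gradedBasisEquiv b), Nat.card_eq_fintype_card, Fintype.card_sigma,
    Finsupp.sum]
  simp only [Fintype.card_fin]
  exact Finset.sum_coe_sort b.support fun j => b j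

theorem linearCombination_one_surjective (I : Ideal (MvPolynomial V K)) {b : ℕ →₀ ℕ}
    (hb : b = Finsupp.single 0 1) :
    Function.Surjective (Finsupp.linearCombination (MvPolynomial V K)
      fun _ : Σ j : ℕ, Fin (b j) => (1 : MvPolynomial V K ⧸ I)) := by
  subst hb
  intro y
  obtain ⟨x, rfl⟩ := Ideal.Quotient.mk_surjective y
  refine ⟨Finsupp.single ⟨0, ⟨0, by simp⟩⟩ x, ?_⟩
  rw [Finsupp.linearCombination_single]
  change Ideal.Quotient.mk I (x • 1) = _
  rw [smul_eq_mul, mul_one]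

theorem constantCoeff_linearMap_eq_zero {ι ι' : Type*}
    (d : (ι →₀ MvPolynomial V K) →ₗ[MvPolynomial V K] (ι' →₀ MvPolynomial V K))
    (h : ∀ b a, constantCoeff (d (Finsupp.single b 1) a) = 0) (x : ι →₀ MvPolynomial V K)
    (a : ι') : constantCoeff (d x a) = 0 := by
  induction x using Finsupp.induction_linear with
  | zero => simp
  | add x y hx hy => rw [map_add, Finsupp.add_apply, map_add, hx, hy, add_zero]
  | single b r =>
    rw [← mul_one r, ← smul_eq_mul, ← Finsupp.smul_single, map_smul, Finsupp.smul_apply,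
      smul_eq_mul, map_mul, h, mul_zero]

end Betti

/-! ### Existence of minimal graded free resolutions -/

section Graded

variable {K V : Type*} [Field K]

/-- The element `x` of the free module with basis elements `a` of degree `deg a` is homogeneous of
degree `n`. -/
def IsHomogeneousElement {ι : Type*} (deg : ι → ℕ) (n : ℕ) (x : ι →₀ MvPolynomial V K) : Prop :=
  ∀ a, ∀ m ∈ (x a).support, deg a + m.degree = n

section

variable {ι : Type*} [Finite ι] (deg : ι → ℕ)

/-- The homogeneous component of degree `n` in the free module with basis elements `a` of degree
`deg a`. -/
noncomputable def degreeComponent (n : ℕ) :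
    (ι →₀ MvPolynomial V K) →ₗ[K] (ι →₀ MvPolynomial V K) where
  toFun x := Finsupp.equivFunOnFinite.symm fun a =>
    if deg a ≤ n then homogeneousComponent (n - deg a) (x a) else 0
  map_add' x y := by
    ext1 a
    by_cases h : deg a ≤ n <;> simp [h]
  map_smul' c x := by
    ext1 a
    by_cases h : deg a ≤ n <;> simp [h]

theorem coeff_degreeComponent (n : ℕ) (x : ι →₀ MvPolynomial V K) (a : ι) (m : V →₀ ℕ) :
    coeff m (degreeComponent deg n x a) = if deg a + m.degree = n then coeff m (x a) else 0 := by
  change coeff m (if deg a ≤ n then homogeneousComponent (n - deg a) (x a) else 0) = _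
  by_cases h : deg a ≤ n
  · rw [if_pos h, coeff_homogeneousComponent]
    by_cases h1 : deg a + m.degree = n
    · rw [if_pos h1, if_pos (by omega)]
    · rw [if_neg h1, if_neg (by omega)]
  · rw [if_neg h, if_neg (by omega), coeff_zero]

theorem isHomogeneousElement_degreeComponent (n : ℕ) (x : ι →₀ MvPolynomial V K) :
    IsHomogeneousElement deg n (degreeComponent deg n x) := by
  intro a m hm
  rw [mem_support_iff, coeff_degreeComponent] at hm
  by_contra h
  exact hm (if_neg h)

variable {deg}

theorem degreeComponent_eq_ite {n l : ℕ} {x : ι →₀ MvPolynomial V K}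
    (hx : IsHomogeneousElement deg n x) :
    degreeComponent deg l x = if n = l then x else 0 := by
  ext a m
  rw [coeff_degreeComponent]
  by_cases hm : coeff m (x a) = 0
  · split_ifs <;> simp [hm]
  · have := hx a m (mem_support_iff.mpr hm)
    by_cases h : n = l
    · rw [if_pos h, if_pos (by omega)]
    · rw [if_neg h, if_neg (by omega)]
      simp

theorem exists_sum_degreeComponent (x : ι →₀ MvPolynomial V K) :
    ∃ N, ∑ n ∈ Finset.range N, degreeComponent deg n x = x := by
  have := Fintype.ofFinite ι
  refine ⟨(∑ a, (deg a + (x a).totalDegree)) + 1, ?_⟩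
  ext a m
  rw [Finsupp.finsetSum_apply, coeff_sum]
  simp only [coeff_degreeComponent]
  rw [Finset.sum_ite_eq]
  by_cases hm : coeff m (x a) = 0
  · simp [hm]
  · refine if_pos (Finset.mem_range.mpr (Nat.lt_succ_of_le ?_))
    have h1 := Finset.single_le_sum (f := fun a => deg a + (x a).totalDegree)
      (fun _ _ => Nat.zero_le _) (Finset.mem_univ a)
    have h2 := le_totalDegree (mem_support_iff.mpr hm)
    have h3 : m.degree = m.sum fun _ e => e := rfl
    change deg a + (x a).totalDegree ≤ _ at h1
    omega

end

theorem IsHomogeneousElement.monomial_smul {ι : Type*} {deg : ι → ℕ} {n : ℕ}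
    {x : ι →₀ MvPolynomial V K} (hx : IsHomogeneousElement deg n x) (μ : V →₀ ℕ) (c : K) :
    IsHomogeneousElement deg (n + μ.degree) (monomial μ c • x) := by
  classical
  intro a m hm
  rw [mem_support_iff, Finsupp.smul_apply, smul_eq_mul, coeff_monomial_mul'] at hm
  split_ifs at hm with h
  · have h1 := hx a (m - μ) (mem_support_iff.mpr (right_ne_zero_of_mul hm))
    have h2 : (m - μ).degree + μ.degree = m.degree := by
      rw [← map_add, tsub_add_cancel_of_le h]
    omega
  · exact absurd rfl hm

theorem isHomogeneousElement_single {ι : Type*} (deg : ι → ℕ) (b : ι) :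
    IsHomogeneousElement deg (deg b) (Finsupp.single b (1 : MvPolynomial V K)) := by
  classical
  intro a m hm
  rw [Finsupp.single_apply] at hm
  split_ifs at hm with h
  · subst h
    rw [mem_support_iff, coeff_one] at hm
    have : m = 0 := by
      by_contra h0
      exact hm (if_neg (Ne.symm h0))
    simp [this]
  · simp at hm

theorem map_degreeComponent {ι ι' : Type*} [Finite ι] [Finite ι'] {deg : ι → ℕ} {deg' : ι' → ℕ}
    {d : (ι →₀ MvPolynomial V K) →ₗ[MvPolynomial V K] (ι' →₀ MvPolynomial V K)}
    (hd : ∀ b, IsHomogeneousElement deg' (deg b) (d (Finsupp.single b 1))) (n : ℕ)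
    (x : ι →₀ MvPolynomial V K) :
    d (degreeComponent deg n x) = degreeComponent deg' n (d x) := by
  induction x using Finsupp.induction_linear with
  | zero => simp
  | add x y hx hy => rw [map_add, map_add, map_add, map_add, hx, hy]
  | single b p =>
    induction p using MvPolynomial.induction_on' with
    | monomial μ c =>
      have h1 : (Finsupp.single b (monomial μ c) : ι →₀ MvPolynomial V K) =
          monomial μ c • Finsupp.single b 1 := by
        rw [Finsupp.smul_single, smul_eq_mul, mul_one]
      have h2 : d (monomial μ c • Finsupp.single b 1) = monomial μ c • d (Finsupp.single b 1) :=
        map_smul d _ _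
      rw [h1, h2, degreeComponent_eq_ite ((isHomogeneousElement_single deg b).monomial_smul μ c),
        degreeComponent_eq_ite ((hd b).monomial_smul μ c)]
      split_ifs
      · exact h2
      · exact map_zero d
    | add p q hp hq => rw [Finsupp.single_add, map_add, map_add, map_add, map_add, hp, hq]

/-- A finite set with a degree function is the basis of a graded free module. -/
theorem exists_gradedBasis {κ : Type*} [Finite κ] (e : κ → ℕ) :
    ∃ (b : ℕ →₀ ℕ) (σ : (Σ j : ℕ, Fin (b j)) ≃ κ), ∀ c, e (σ c) = c.1 := by
  classical
  have := Fintype.ofFinite κ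
  let b : ℕ →₀ ℕ := Finsupp.onFinset (Finset.univ.image e)
    (fun j => Fintype.card {x // e x = j}) fun j hj => by
      obtain ⟨x⟩ := Fintype.card_pos_iff.mp (Nat.pos_of_ne_zero hj)
      exact Finset.mem_image.mpr ⟨x.1, Finset.mem_univ _, x.2⟩
  let τ : ∀ j, Fin (b j) ≃ {x // e x = j} := fun j => (Fintype.equivFin {x // e x = j}).symm
  exact ⟨b, (Equiv.sigmaCongrRight τ).trans (Equiv.sigmaFiberEquiv e), fun c => (τ c.1 c.2).2⟩

variable {ι : Type*} {deg : ι → ℕ}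
  {N : Submodule (MvPolynomial V K) (ι →₀ MvPolynomial V K)}

theorem exists_generators_gradedBasis {κ : Type*} [Finite κ] {g : κ → ι →₀ MvPolynomial V K}
    {e : κ → ℕ} (hg : ∀ i, IsHomogeneousElement deg (e i) (g i))
    (hspan : Submodule.span (MvPolynomial V K) (Set.range g) = N) :
    ∃ (b : ℕ →₀ ℕ) (g' : (Σ j : ℕ, Fin (b j)) → ι →₀ MvPolynomial V K),
      Nat.card (Σ j : ℕ, Fin (b j)) = Nat.card κ ∧
      (∀ c, IsHomogeneousElement deg c.1 (g' c)) ∧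
      Submodule.span (MvPolynomial V K) (Set.range g') = N := by
  obtain ⟨b, σ, hσ⟩ := exists_gradedBasis e
  refine ⟨b, g ∘ σ, Nat.card_congr σ, fun c => hσ c ▸ hg (σ c), ?_⟩
  rw [σ.surjective.range_comp, hspan]

/-- A graded submodule of a graded free module is the image of a graded free module under a
degree-preserving map with kernel contained in the product with the maximal ideal: take a
homogeneous generating family with the least number of elements. -/
theorem exists_minimal_cover [Finite ι] [Finite V]
    (hN : ∀ x ∈ N, ∀ n, degreeComponent deg n x ∈ N) :
    ∃ (b : ℕ →₀ ℕ) (d : GradedFree K V b →ₗ[MvPolynomial V K] (ι →₀ MvPolynomial V K)),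
      (∀ c, IsHomogeneousElement deg c.1 (d (Finsupp.single c 1))) ∧ LinearMap.range d = N ∧
      ∀ x, d x = 0 → ∀ a, constantCoeff (x a) = 0 := by
  classical
  have hex : ∃ n, ∃ (b : ℕ →₀ ℕ) (g : (Σ j : ℕ, Fin (b j)) → ι →₀ MvPolynomial V K),
      Nat.card (Σ j : ℕ, Fin (b j)) = n ∧ (∀ c, IsHomogeneousElement deg c.1 (g c)) ∧
      Submodule.span (MvPolynomial V K) (Set.range g) = N := by
    obtain ⟨s, hs⟩ := IsNoetherian.noetherian N
    have hsN : ∀ x ∈ s, x ∈ N := fun x hx => hs ▸ Submodule.subset_span hx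
    choose M hM using exists_sum_degreeComponent (K := K) (V := V) (deg := deg)
    let κ := Σ x : s, Fin (M x)
    obtain ⟨b, g, -, hb⟩ := exists_generators_gradedBasis (κ := κ) (N := N)
      (g := fun p => degreeComponent deg p.2 p.1.1) (e := fun p => p.2)
      (fun p => isHomogeneousElement_degreeComponent deg _ _) (by
        apply le_antisymm
        · rw [Submodule.span_le]
          rintro _ ⟨p, rfl⟩
          exact hN _ (hsN _ p.1.2) _
        · rw [← hs, Submodule.span_le]
          intro x hx
          rw [SetLike.mem_coe, ← hM x]
          exact sum_mem fun n hn => Submodule.subset_span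
            ⟨⟨⟨x, hx⟩, ⟨n, Finset.mem_range.mp hn⟩⟩, rfl⟩)
    exact ⟨_, b, g, rfl, hb⟩
  obtain ⟨b, g, hcard, hg, hspan⟩ := Nat.find_spec hex
  have hsingle : ∀ c, Finsupp.linearCombination (MvPolynomial V K) g (Finsupp.single c 1) = g c :=
    fun c => by rw [Finsupp.linearCombination_single, one_smul]
  have hgr : ∀ c : Σ j : ℕ, Fin (b j), IsHomogeneousElement deg c.1
      (Finsupp.linearCombination (MvPolynomial V K) g (Finsupp.single c 1)) := fun c => by
    rw [hsingle]
    exact hg c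
  refine ⟨b, Finsupp.linearCombination (MvPolynomial V K) g, hgr,
    (Finsupp.range_linearCombination _).trans hspan, fun x hx c => ?_⟩
  by_contra hc
  -- The component of the relation `x` in the degree of `c` has an invertible entry at `c`.
  set y := degreeComponent (fun a : Σ j : ℕ, Fin (b j) => a.1) c.1 x with hy
  have hy0 : Finsupp.linearCombination (MvPolynomial V K) g y = 0 := by
    rw [hy, map_degreeComponent hgr, hx, map_zero]
  have hyc : y c = C (constantCoeff (x c)) := by
    ext m
    rw [hy, coeff_degreeComponent, coeff_C]
    by_cases hm : m = 0
    · subst hm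
      simp [constantCoeff_eq]
    · rw [if_neg (Ne.symm hm), if_neg]
      intro h
      exact hm ((Finsupp.degree_eq_zero_iff m).mp (by omega))
  have hmem : g c ∈ Submodule.span (MvPolynomial V K) (Set.range fun a : {a // a ≠ c} => g a) := by
    have h1 : y = Finsupp.single c (y c) + y.erase c := (Finsupp.single_add_erase c y).symm
    rw [h1, map_add, Finsupp.linearCombination_single] at hy0
    have h2 : Finsupp.linearCombination (MvPolynomial V K) g (y.erase c) ∈
        Submodule.span (MvPolynomial V K) (Set.range fun a : {a // a ≠ c} => g a) := by
      rw [Finsupp.linearCombination_apply]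
      refine sum_mem fun a ha => Submodule.smul_mem _ _ (Submodule.subset_span ⟨⟨a, ?_⟩, rfl⟩)
      rw [Finsupp.support_erase] at ha
      exact Finset.ne_of_mem_erase ha
    have h3 : g c = (C (constantCoeff (x c))⁻¹ : MvPolynomial V K) • (y c • g c) := by
      rw [smul_smul, hyc, ← C_mul, inv_mul_cancel₀ hc, C_1, one_smul]
    rw [h3, eq_neg_of_add_eq_zero_left hy0]
    exact Submodule.smul_mem _ _ (neg_mem h2)
  obtain ⟨b', g', hcard', hb'⟩ := exists_generators_gradedBasis (κ := {a // a ≠ c}) (N := N)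
    (g := fun a => g a) (e := fun a => a.1.1) (fun a => hg a) (by
      rw [← hspan]
      apply le_antisymm
      · refine Submodule.span_mono ?_
        rintro _ ⟨a, rfl⟩
        exact ⟨a, rfl⟩
      · rw [Submodule.span_le]
        rintro _ ⟨a, rfl⟩
        by_cases ha : a = c
        · exact ha ▸ hmem
        · exact Submodule.subset_span ⟨⟨a, ha⟩, rfl⟩)
  have hlt : Nat.card {a // a ≠ c} < Nat.find hex := by
    rw [← hcard]
    exact Finite.card_subtype_lt (x := c) (by simp)
  exact Nat.find_min hex hlt ⟨b', g', hcard', hb'⟩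

end Graded

section Existence

variable {K V : Type*} [Field K] [Finite V]

variable (K V) in
/-- A degree-preserving map of graded free modules whose kernel is contained in the product of the
source with the maximal ideal: one step of a minimal resolution. -/
structure MinimalStep where
  /-- the number of basis elements of each degree of the target -/
  target : ℕ →₀ ℕ
  /-- the number of basis elements of each degree of the source -/
  source : ℕ →₀ ℕ
  /-- the map -/
  map : GradedFree K V source →ₗ[MvPolynomial V K] GradedFree K V target
  /-- The map preserves degrees. -/
  graded : ∀ c, IsHomogeneousElement (fun a : Σ j : ℕ, Fin (target j) => a.1) c.1
    (map (Finsupp.single c 1))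
  /-- Elements of the kernel have coordinates without constant term. -/
  minimal : ∀ x, map x = 0 → ∀ a, constantCoeff (x a) = 0

theorem MinimalStep.exists_next (s : MinimalStep K V) :
    ∃ (b : ℕ →₀ ℕ) (d : GradedFree K V b →ₗ[MvPolynomial V K] GradedFree K V s.source),
      (∀ c, IsHomogeneousElement (fun a : Σ j : ℕ, Fin (s.source j) => a.1) c.1
        (d (Finsupp.single c 1))) ∧ LinearMap.range d = LinearMap.ker s.map ∧
      ∀ x, d x = 0 → ∀ a, constantCoeff (x a) = 0 :=
  exists_minimal_cover fun x hx n => by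
    rw [LinearMap.mem_ker] at hx ⊢
    rw [map_degreeComponent s.graded, hx, map_zero]

/-- A minimal cover of the kernel of a step is the next step of the resolution. -/
noncomputable def MinimalStep.next (s : MinimalStep K V) : MinimalStep K V where
  target := s.source
  source := s.exists_next.choose
  map := s.exists_next.choose_spec.choose
  graded := s.exists_next.choose_spec.choose_spec.1
  minimal := s.exists_next.choose_spec.choose_spec.2.2

theorem MinimalStep.exact_next (s : MinimalStep K V) : Function.Exact s.next.map s.map :=
  LinearMap.exact_iff.mpr s.exists_next.choose_spec.choose_spec.2.1.symm

/-- The steps of a resolution that starts with a given one. -/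
noncomputable def MinimalStep.iterate (s : MinimalStep K V) (n : ℕ) : MinimalStep K V :=
  Nat.rec s (fun _ t => t.next) n

theorem MinimalStep.constantCoeff_iterate (s : MinimalStep K V)
    (hs : ∀ x a, constantCoeff (s.map x a) = 0) :
    ∀ n x a, constantCoeff ((s.iterate n).map x a) = 0
  | 0 => hs
  | n + 1 => fun x => (s.iterate n).minimal _ ((s.iterate n).exact_next.apply_apply_eq_zero x)

end Existence

/-! ### Betti numbers of Stanley–Reisner rings of independence complexes -/

section StanleyReisner

variable {K V : Type*} [Field K] {G : SimpleGraph V} {I : Ideal (MvPolynomial V K)}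

/-- The terms of a minimal resolution of the Stanley–Reisner ring have the ranks given by Hochster's
formula. -/
theorem sum_eq_sum_cohDim [LinearOrder V] [Fintype V]
    (hI : ∀ f, f ∈ I ↔ ∀ μ ∈ f.support, ¬G.IsIndepSet (μ.support : Set V)) {β : ℕ → ℕ →₀ ℕ}
    (hβ : β 0 = Finsupp.single 0 1)
    {d : ∀ i : ℕ, GradedFree K V (β (i + 1)) →ₗ[MvPolynomial V K] GradedFree K V (β i)}
    (hexact₀ : Function.Exact (d 0) (Finsupp.linearCombination (MvPolynomial V K)
      fun _ : Σ j : ℕ, Fin (β 0 j) => (1 : MvPolynomial V K ⧸ I)))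
    (hexact : ∀ i, Function.Exact (d (i + 1)) (d i))
    (hmin : ∀ i x a, constantCoeff (d i x a) = 0) (i : ℕ) :
    ((β i).sum fun _ n => n) = ∑ W : Finset V, cohDim K G W (W.card - i) := by
  have h := koszulDim_eq_card_of_resolution i (ι := fun i => Σ j : ℕ, Fin (β i j)) d _
    (linearCombination_one_surjective I hβ) hexact₀ hexact hmin
  rw [koszulDim_quotient hI, card_gradedBasis] at h
  rw [← h]
  refine Finset.sum_congr rfl fun W _ => ?_
  congr 1
  ring

theorem linearCombination_one_eq_zero_iff {b : ℕ →₀ ℕ} (hb : b = Finsupp.single 0 1)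
    (x : GradedFree K V b) :
    Finsupp.linearCombination (MvPolynomial V K)
      (fun _ : Σ j : ℕ, Fin (b j) => (1 : MvPolynomial V K ⧸ I)) x = 0 ↔ ∀ a, x a ∈ I := by
  have hsub : Subsingleton (Σ j : ℕ, Fin (b j)) := by
    rw [← Finite.card_le_one_iff_subsingleton, card_gradedBasis, hb]
    simp
  let c : Σ j : ℕ, Fin (b j) := ⟨0, ⟨0, by simp [hb]⟩⟩
  have hx : x = Finsupp.single c (x c) := by
    ext1 a
    rw [Subsingleton.elim a c, Finsupp.single_eq_same]
  have hmk : (x c) • (1 : MvPolynomial V K ⧸ I) = Ideal.Quotient.mk I (x c) := by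
    change Ideal.Quotient.mk I (x c • 1) = _
    rw [smul_eq_mul, mul_one]
  rw [hx, Finsupp.linearCombination_single, hmk, Ideal.Quotient.eq_zero_iff_mem, ← hx]
  exact ⟨fun h a => Subsingleton.elim c a ▸ h, fun h => h c⟩

/-- The canonical surjection of the polynomial ring onto the Stanley–Reisner ring starts a minimal
resolution. -/
theorem exists_minimalStep [Finite V]
    (hI : ∀ f, f ∈ I ↔ ∀ μ ∈ f.support, ¬G.IsIndepSet (μ.support : Set V)) :
    ∃ s : MinimalStep K V, s.target = Finsupp.single 0 1 ∧
      Function.Exact s.map (Finsupp.linearCombination (MvPolynomial V K)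
        fun _ : Σ j : ℕ, Fin (s.target j) => (1 : MvPolynomial V K ⧸ I)) ∧
      ∀ x a, constantCoeff (s.map x a) = 0 := by
  let π := Finsupp.linearCombination (MvPolynomial V K)
    fun _ : Σ j : ℕ, Fin (Finsupp.single (0 : ℕ) (1 : ℕ) j) => (1 : MvPolynomial V K ⧸ I)
  have hπ : ∀ x, π x = 0 ↔ ∀ a, x a ∈ I := linearCombination_one_eq_zero_iff rfl
  obtain ⟨b, d, hgr, hrange, hmin⟩ := exists_minimal_cover
    (deg := fun a : Σ j : ℕ, Fin (Finsupp.single (0 : ℕ) (1 : ℕ) j) => a.1)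
    (N := LinearMap.ker π) (fun x hx n => by
      rw [LinearMap.mem_ker, hπ] at hx ⊢
      intro a
      rw [hI]
      intro μ hμ
      rw [mem_support_iff, coeff_degreeComponent] at hμ
      refine (hI _).mp (hx a) μ (mem_support_iff.mpr fun h => hμ ?_)
      rw [h, ite_self])
  refine ⟨⟨_, b, d, hgr, hmin⟩, rfl, LinearMap.exact_iff.mpr hrange.symm, fun x a => ?_⟩
  have hx : d x ∈ LinearMap.ker π := hrange ▸ LinearMap.mem_range_self d x
  rw [LinearMap.mem_ker, hπ] at hx
  by_contra h
  rw [constantCoeff_eq, ← ne_eq, ← mem_support_iff] at h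
  exact (hI _).mp (hx a) 0 h (by simp [SimpleGraph.isIndepSet_iff])

theorem nonempty_minimalGradedFreeResolution [Finite V]
    (hI : ∀ f, f ∈ I ↔ ∀ μ ∈ f.support, ¬G.IsIndepSet (μ.support : Set V)) :
    Nonempty (MinimalGradedFreeResolution I) := by
  have := Fintype.ofFinite V
  let _ : LinearOrder V := LinearOrder.lift' (Fintype.equivFin V) (Equiv.injective _)
  obtain ⟨s, hs, hexact, hmin⟩ := exists_minimalStep hI
  have hexact' : ∀ i, Function.Exact (s.iterate (i + 1)).map (s.iterate i).map := fun i =>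
    (s.iterate i).exact_next
  refine ⟨{
    β := fun i => (s.iterate i).target
    d := fun i => (s.iterate i).map
    β_zero := hs
    finite_length := ⟨Fintype.card V, fun i hi => ?_⟩
    graded := fun i => (s.iterate i).graded
    minimal := fun i b => s.constantCoeff_iterate hmin i _
    exact_zero := hexact
    exact_succ := hexact' }⟩
  have h := sum_eq_sum_cohDim (β := fun i => (s.iterate i).target) hI hs
    (d := fun i => (s.iterate i).map) hexact hexact' (s.constantCoeff_iterate hmin) i
  rw [Finset.sum_eq_zero fun W _ => (acyclic_of_card_lt_zero W (by
    have := W.card_le_univ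
    omega)).cohDim_eq_zero] at h
  ext j
  by_contra hj
  exact hj (Finset.sum_eq_zero_iff.mp h j (Finsupp.mem_support_iff.mpr hj))

theorem mem_stanleyReisnerIdeal_iff {f : MvPolynomial V K} :
    f ∈ stanleyReisnerIdeal K (independenceComplex G) ↔
      ∀ μ ∈ f.support, ¬G.IsIndepSet (μ.support : Set V) := by
  rw [stanleyReisnerIdeal_independenceComplex, mem_edgeIdeal_iff]

theorem betti_eq_sum_cohDim [LinearOrder V] [Fintype V]
    (F : MinimalGradedFreeResolution (stanleyReisnerIdeal K (independenceComplex G))) (i : ℕ) :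
    F.betti i = ∑ W : Finset V, cohDim K G W (W.card - i) :=
  sum_eq_sum_cohDim (fun _ => mem_stanleyReisnerIdeal_iff) F.β_zero F.exact_zero F.exact_succ
    (fun j => constantCoeff_linearMap_eq_zero _ (F.minimal j)) i

end StanleyReisner

theorem mainTheorem1 {V : Type*} [Finite V] (G : SimpleGraph V) :
    (∀ (K : Type*) [Field K],
      Nonempty (MinimalGradedFreeResolution (stanleyReisnerIdeal K (independenceComplex G)))) ∧
    ∀ (K : Type*) [Field K] (L : Type*) [Field L]
      (F : MinimalGradedFreeResolution (stanleyReisnerIdeal K (independenceComplex G)))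
      (F' : MinimalGradedFreeResolution (stanleyReisnerIdeal L (independenceComplex G))),
      ∀ i ≤ 5, F.betti i = F'.betti i := by
  refine ⟨fun K _ => nonempty_minimalGradedFreeResolution fun _ => mem_stanleyReisnerIdeal_iff,
    fun K _ L _ F F' i hi => ?_⟩
  have := Fintype.ofFinite V
  let _ : LinearOrder V := LinearOrder.lift' (Fintype.equivFin V) (Equiv.injective _)
  rw [betti_eq_sum_cohDim, betti_eq_sum_cohDim]
  exact Finset.sum_congr rfl fun W _ => fieldIndep_of_card_sub_le_five (by omega)
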